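/- Let $p$ be a prime number and let $R$ be a regular (in particular Noetherian) ring of characteristic $p$ which is $F$-finite, i.e. a finitely generated module over itself via the Frobenius endomorphism. Assume that either (a) $R$ is local, with maximal ideal $\mathfrak m$; or (b) $R=K[x_1,\dots,x_d]$ is a standard graded polynomial ring over a field $K$, with $\mathfrak m=(x_1,\dots,x_d)$. Let $I\subseteq R$ be a radical ideal, which in case (b) is assumed to be homogeneous. Let $H$ be the big height of $I$, that is, the largest height of a minimal prime of $I$ (with $H=0$ if $I=R$), and let $\delta=1$ if $p\le H$ and $\delta=0$ otherwise. For $n\ge 0$ let $I^{(n)}=I^nR_W\cap R$ be the $n$-th symbolic power, where $W$ is the complement of the union of the minimal primes of $I$. For an ideal $J$ let $J^{[p]}$ be the ideal generated by the $p$-th powers of the elements of $J$. A sequence of ideals $\{I_n\}_{n\ge0}$ is an $F$-pure filtration if $I_0=R$, $I_{n+1}\subseteq I_n$ and $I_nI_m\subseteq I_{n+m}$ for all $n,m\ge 0$, and there is an $R$-linear splitting $\phi:R^{1/p}\to R$ of the inclusion $R\subseteq R^{1/p}$ with $\phi\big((I_{np+1})^{1/p}\big)\subseteq I_{n+1}$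 for all $n\ge0$. The ideal $I$ is symbolic $F$-pure if $\{I^{(n)}\}_{n\ge 0}$ is an $F$-pure filtration. Then $I$ is symbolic $F$-pure if and only if $$\bigcap_{n=0}^{\max\{0,\,H-1-\delta\}}\Big(\big(I^{(n+1)}\big)^{[p]}:_R I^{(np+1)}\Big)\not\subseteq \mathfrak m^{[p]}.$$ In case (b) the same equivalence holds if, in the definition of symbolic $F$-purity, the splitting $\phi$ is moreover required to be homogeneous, i.e. degree preserving for the $\frac1p\mathbb Z_{\ge0}$-grading of $R^{1/p}$. -/

import Mathlib

namespace SymbolicFPure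

/-- The multiplicative set `W`: the complement of the union of the minimal primes of `I`. -/
def minimalPrimesCompl {R : Type*} [CommRing R] (I : Ideal R) : Submonoid R where
  carrier := {w | ∀ q ∈ I.minimalPrimes, w ∉ q}
  one_mem' := fun q hq h => hq.1.1.ne_top ((Ideal.eq_top_iff_one q).2 h)
  mul_mem' := fun ha hb q hq h => (hq.1.1.mem_or_mem h).elim (ha q hq) (hb q hq)

/-- The `n`-th symbolic power `I^(n) = I^n R_W ∩ R`, where `R_W` is the localization of `R` at the
complement `W` of the union of the minimal primes of `I`. -/
def symbolicPower {R : Type*} [CommRing R] (I : Ideal R) (n : ℕ) : Ideal R :=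
  ((I ^ n).map (algebraMap R (Localization (minimalPrimesCompl I)))).comap
    (algebraMap R (Localization (minimalPrimesCompl I)))

/-- The big height of `I`: the largest height of a minimal prime of `I`
(with the value `0` for the unit ideal, which has no minimal prime). -/
noncomputable def bigHeight {R : Type*} [CommRing R] (I : Ideal R) : ℕ∞ :=
  ⨆ q ∈ I.minimalPrimes, q.height

/-- In a Noetherian ring the big height of an ideal is a natural number. -/
theorem exists_bigHeight_eq {R : Type*} [CommRing R] [IsNoetherianRing R] (I : Ideal R) :
    ∃ H : ℕ, bigHeight I = H := by
  have hf := I.finite_minimalPrimes_of_isNoetherianRing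
  obtain ⟨N, hN⟩ := (hf.image (fun q => q.height.toNat)).bddAbove
  have hle : ∀ q ∈ I.minimalPrimes, q.height ≤ N := fun q hq => by
    have := hq.1.1
    rw [← ENat.natCast_toNat (Ideal.height_lt_top (I := q) this.ne_top).ne]
    exact_mod_cast hN ⟨q, hq, rfl⟩
  exact ⟨_, (ENat.natCast_toNat ((iSup₂_le hle).trans_lt (ENat.natCast_lt_top N)).ne).symm⟩

/-- The Frobenius power `I^[p]`, the ideal generated by the `p`-th powers of the elements
of `I`. -/
def frobeniusPower {R : Type*} [CommRing R] (p : ℕ) (I : Ideal R) : Ideal R :=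
  Ideal.span ((fun x => x ^ p) '' (I : Set R))

/-- A splitting `R^{1/p} → R` of the inclusion `R ⊆ R^{1/p}`. An element `x^{1/p}` of `R^{1/p}` is
represented by `x : R`, so that `R^{1/p}` is the additive group of `R` with the scalar
multiplication `r • x = r ^ p * x`, and `φ x` stands for `φ(x^{1/p})`. -/
structure IsFrobeniusSplitting {R : Type*} [CommRing R] (p : ℕ) (φ : R →+ R) : Prop where
  map_pow_mul : ∀ r x : R, φ (r ^ p * x) = r * φ x
  map_one : φ 1 = 1

/-- The sequence `𝓘` of ideals is a filtration: `𝓘₀ = R`, it is decreasing,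
and `𝓘ₙ 𝓘ₘ ⊆ 𝓘ₙ₊ₘ`. -/
structure IsFiltration {R : Type*} [CommRing R] (𝓘 : ℕ → Ideal R) : Prop where
  zero : 𝓘 0 = ⊤
  succ_le : ∀ n, 𝓘 (n + 1) ≤ 𝓘 n
  mul_le : ∀ n m, 𝓘 n * 𝓘 m ≤ 𝓘 (n + m)

/-- `𝓘` is an `F`-pure filtration: a filtration with a splitting `φ : R^{1/p} → R` such that
`φ((𝓘_{np+1})^{1/p}) ⊆ 𝓘_{n+1}` for all `n`. -/
def IsFPureFiltration {R : Type*} [CommRing R] (p : ℕ) (𝓘 : ℕ → Ideal R) : Prop :=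
  IsFiltration 𝓘 ∧ ∃ φ : R →+ R, IsFrobeniusSplitting p φ ∧
    ∀ n, ∀ x ∈ 𝓘 (n * p + 1), φ x ∈ 𝓘 (n + 1)

/-- `I` is symbolic `F`-pure: its symbolic powers form an `F`-pure filtration. -/
def IsSymbolicFPure {R : Type*} [CommRing R] (p : ℕ) (I : Ideal R) : Prop :=
  IsFPureFiltration p (symbolicPower I)

/-- For `R = K[x_i : i ∈ σ]` with its standard grading, and `R^{1/p}` graded by `(1/p) ℕ` with
`x^{1/p}` of degree `d/p` if `x` is homogeneous of degree `d`: the map `φ : R^{1/p} → R` preserves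
degrees. -/
def IsDegreePreserving {K σ : Type*} [Field K] (p : ℕ)
    (φ : MvPolynomial σ K →+ MvPolynomial σ K) : Prop :=
  (∀ (d : ℕ) (x : MvPolynomial σ K), x.IsHomogeneous (p * d) → (φ x).IsHomogeneous d) ∧
    ∀ (d : ℕ) (x : MvPolynomial σ K), ¬ p ∣ d → x.IsHomogeneous d → φ x = 0

/-- The graded form of symbolic `F`-purity: the splitting is required to be homogeneous. -/
def IsGradedSymbolicFPure {K σ : Type*} [Field K] (p : ℕ) (I : Ideal (MvPolynomial σ K)) : Prop :=
  IsFiltration (symbolicPower I) ∧ ∃ φ : MvPolynomial σ K →+ MvPolynomial σ K,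
    IsFrobeniusSplitting p φ ∧ IsDegreePreserving p φ ∧
      ∀ n, ∀ x ∈ symbolicPower I (n * p + 1), φ x ∈ symbolicPower I (n + 1)

/-- The intersection over `0 ≤ n ≤ N` of the colon ideals `((I^(n+1))^[p] : I^(np+1))`. -/
def colonIntersection {R : Type*} [CommRing R] (p : ℕ) (I : Ideal R) (N : ℤ) : Ideal R :=
  ⨅ (n : ℕ) (_ : (n : ℤ) ≤ N),
    (frobeniusPower p (symbolicPower I (n + 1))).colon (symbolicPower I (n * p + 1) : Set R)

end SymbolicFPure

open SymbolicFPure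

-- The standard grading of a polynomial ring, in which every variable has degree one.
attribute [local instance] MvPolynomial.gradedAlgebra

/-!
Throughout, `p⁻¹`-linear maps `φ : R → R`, those with `φ (r ^ p * x) = r * φ x`, stand for the
`R`-linear maps `R^{1/p} → R`.

Duality for Frobenius. In both cases there is one `p⁻¹`-linear map `Φ` for which `R^{1/p}` has dual
bases with respect to the pairing `(y, z) ↦ Φ (y z)` (`IsFrobeniusDualBasis`). Hence every
`p⁻¹`-linear map is of the form `Φ (f ·)`, and `Φ (f J) ⊆ J'` for ideals `J`, `J'` if and only if
`f J ⊆ J'^[p]`. So the maps carrying all `I^(np+1)` into `I^(n+1)` correspond to the elements `f` of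
*all* the colon ideals `((I^(n+1))^[p] : I^(np+1))`, and `f ∉ 𝔪^[p]` means that `Φ (r f) ∉ 𝔪` for
some `r`. For a regular local ring, `R^{1/p}` is free because a regular system of parameters is a
regular sequence on it, and `Φ` is a coordinate that is a unit at the socle generator
`∏ i, x i ^ (p - 1)` (`IsRegularSystem.exists_isFrobeniusDualBasis`). For a polynomial ring, `Φ` is
the usual trace (`MvPolynomial.isFrobeniusDualBasis_frobeniusTrace`).

Finitely many colon ideals suffice. Localize at a minimal prime `q` of `I`, of height `h`; since `I`
is radical, `I^(n)` becomes the power `𝔫 ^ n` of the maximal ideal of a regular local ring. Every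
colon ideal contains `𝔫 ^ (h (p - 1))`, by the pigeonhole principle
(`span_range_pow_le_frobeniusPower`). The one with index `N` is contained in it once
`h (p - 1) ≤ p (N + 1)` (`IsRegularSystem.mem_pow_of_forall_mul_mem`), because monomials in a
regular system of parameters behave like monomials in a polynomial ring as far as membership in
monomial ideals is concerned. This holds for `N = max 0 (H - 1 - δ)` and all `h ≤ H`. The local
statements for all `q` are put together in `map_mul_mem_symbolicPower`.

From `Φ (r f ·)` to a splitting. In the local case, divide by the unit `Φ (r f)`. In the graded
case, symbolic powers of homogeneous ideals are homogeneous
(`MvPolynomial.homogeneousComponent_mem_symbolicPower`), so the degree preserving part of the map is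
still compatible with them. It sends `1` to the nonzero constant term of `Φ (r f)`, and dividing by
this constant gives a homogeneous splitting.
-/

section

open IsLocalRing Finset

/-! ### Regular systems of parameters -/

theorem IsLocalRing.map_quotientMk_maximalIdeal {S : Type*} [CommRing S] [IsLocalRing S]
    (J : Ideal S) [IsLocalRing (S ⧸ J)] :
    (maximalIdeal S).map (Ideal.Quotient.mk J) = maximalIdeal (S ⧸ J) := by
  have hJ : J ≤ maximalIdeal S := le_maximalIdeal fun h => by
    exact not_subsingleton (S ⧸ J) (Ideal.Quotient.subsingleton_iff.2 h)
  have := Ideal.IsMaximal.map_of_surjective_of_ker_le (f := Ideal.Quotient.mk J)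
    Ideal.Quotient.mk_surjective (m := maximalIdeal S) (by simpa using hJ)
  exact eq_maximalIdeal this

theorem IsLocalRing.quotient_span {S : Type*} [CommRing S] [IsLocalRing S] {s : Set S}
    (hs : s ⊆ maximalIdeal S) : IsLocalRing (S ⧸ Ideal.span s) :=
  have : Nontrivial (S ⧸ Ideal.span s) := Ideal.Quotient.nontrivial_iff.2 fun h =>
    (maximalIdeal.isMaximal S).ne_top (top_le_iff.1 (h ▸ Ideal.span_le.2 hs))
  IsLocalRing.of_surjective' _ Ideal.Quotient.mk_surjective

/-- A regular local ring is a domain. By induction on the dimension: an element `x` of the maximal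
ideal outside its square and outside all minimal primes cuts out a regular local ring of smaller
dimension, so `x` generates a prime, and a minimal prime contained in `(x)` vanishes by Nakayama's
lemma. -/
theorem IsLocalRing.isDomain_of_span_eq_maximalIdeal (n : ℕ) :
    ∀ {S : Type*} [CommRing S] [IsLocalRing S] [IsNoetherianRing S] (T : Finset S),
      Ideal.span (T : Set S) = maximalIdeal S → T.card ≤ n → (n : ℕ∞) ≤ (maximalIdeal S).height →
      IsDomain S := by
  classical
  induction n with
  | zero =>
    intro S _ _ _ T hT hc _
    obtain rfl : T = ∅ := Finset.card_eq_zero.1 (Nat.le_zero.1 hc)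
    have : IsField S := isField_iff_maximalIdeal_eq.2 (by simpa using hT.symm)
    exact this.isDomain
  | succ n ih =>
    intro S _ _ _ T hT hc hh
    have hpos : (maximalIdeal S).height ≠ 0 := fun h => by
      rw [h] at hh
      exact absurd hh (by simp)
    have hnot : ¬ maximalIdeal S ∈ minimalPrimes S := fun h => hpos (Ideal.height_eq_zero_iff.2 h)
    obtain ⟨x, hxm, hx2, hxP⟩ : ∃ x ∈ maximalIdeal S, x ∉ maximalIdeal S ^ 2 ∧
        ∀ P ∈ minimalPrimes S, x ∉ P := by
      by_contra! hcon
      have hfin : (insert (maximalIdeal S ^ 2) (minimalPrimes S)).Finite :=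
        (minimalPrimes.finite_of_isNoetherianRing S).insert _
      have := (Ideal.subset_union_prime_finite hfin (f := id) (maximalIdeal S ^ 2)
        (maximalIdeal S ^ 2) (fun i hi h1 _ => (hi.resolve_left h1).1.1)
        (I := maximalIdeal S)).1 (fun x hx => by
          by_cases h2 : x ∈ maximalIdeal S ^ 2
          · exact Set.mem_biUnion (Set.mem_insert _ _) h2
          · obtain ⟨P, hP, hxP⟩ := hcon x hx h2
            exact Set.mem_biUnion (Set.mem_insert_of_mem _ hP) hxP)
      obtain ⟨i, hi, hle⟩ := this
      rcases hi with rfl | hi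
      · have hbot : maximalIdeal S = ⊥ :=
          Submodule.eq_bot_of_le_smul_of_le_jacobson_bot (maximalIdeal S) _
            (IsNoetherian.noetherian _) (by simpa [sq] using hle) (maximalIdeal_le_jacobson _)
        have := (isField_iff_maximalIdeal_eq.2 hbot).isDomain
        exact hpos (Ideal.height_eq_zero_iff_eq_bot.2 hbot)
      · have hip : i.IsPrime := hi.1.1
        have : i = maximalIdeal S := le_antisymm (le_maximalIdeal hip.ne_top) hle
        exact hnot (this ▸ hi)
    -- some generator can be exchanged for `x`
    obtain ⟨a, -, hax⟩ := Submodule.mem_span_finset.1 (show x ∈ Submodule.span S (T : Set S) by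
      change x ∈ Ideal.span (T : Set S); rwa [hT])
    obtain ⟨t, ht, hat⟩ : ∃ t ∈ T, IsUnit (a t) := by
      by_contra! hcon
      refine hx2 (hax ▸ Ideal.sum_mem _ fun t ht => ?_)
      rw [sq, smul_eq_mul]
      exact Ideal.mul_mem_mul ((mem_maximalIdeal _).2 (hcon t ht)) (hT ▸ Ideal.subset_span ht)
    have hloc : IsLocalRing (S ⧸ Ideal.span {x}) :=
      IsLocalRing.quotient_span (Set.singleton_subset_iff.2 hxm)
    set T' : Finset (S ⧸ Ideal.span {x}) := (T.erase t).image (Ideal.Quotient.mk _) with hT'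
    have hspan : Ideal.span (T' : Set (S ⧸ Ideal.span {x})) = maximalIdeal _ := by
      rw [← IsLocalRing.map_quotientMk_maximalIdeal, ← hT, Ideal.map_span]
      apply le_antisymm (Ideal.span_mono _)
      · rw [Ideal.span_le]
        rintro _ ⟨s, hs, rfl⟩
        by_cases hst : s = t
        · subst hst
          have h0 : a s * s + ∑ u ∈ T.erase s, a u * u = x := by
            rw [← hax, ← Finset.add_sum_erase T _ ht]; rfl
          have h1 : Ideal.Quotient.mk (Ideal.span {x}) (a s) * Ideal.Quotient.mk _ s =
              - ∑ u ∈ T.erase s, Ideal.Quotient.mk (Ideal.span {x}) (a u) *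
                Ideal.Quotient.mk _ u := by
            rw [eq_neg_iff_add_eq_zero]
            simp_rw [← map_mul]
            rw [← map_sum, ← map_add, h0]
            exact Ideal.Quotient.eq_zero_iff_mem.2 (Ideal.mem_span_singleton_self x)
          rw [SetLike.mem_coe, ← Ideal.unit_mul_mem_iff_mem _ (hat.map (Ideal.Quotient.mk _)), h1]
          refine neg_mem (Ideal.sum_mem _ fun u hu => Ideal.mul_mem_left _ _ (Ideal.subset_span ?_))
          exact Finset.mem_coe.2 (Finset.mem_image_of_mem _ hu)
        · exact Ideal.subset_span (Finset.mem_coe.2 (Finset.mem_image_of_mem _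
            (Finset.mem_erase.2 ⟨hst, hs⟩)))
      · rw [hT', Finset.coe_image]
        exact Set.image_mono (Finset.coe_subset.2 (Finset.erase_subset _ _))
    have hcard : T'.card ≤ n := Finset.card_image_le.trans (by
      rw [Finset.card_erase_of_mem ht]; omega)
    have hht : (n : ℕ∞) ≤ (maximalIdeal (S ⧸ Ideal.span {x})).height := by
      have := Ideal.height_le_height_add_one_of_mem hxm
      rw [IsLocalRing.map_quotientMk_maximalIdeal] at this
      have h2 := hh.trans this
      rw [Nat.cast_succ] at h2
      exact (ENat.add_le_add_iff_right ENat.one_ne_top).1 h2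
    have hdom := ih T' hspan hcard hht
    have hprime : (Ideal.span {x}).IsPrime := (Ideal.Quotient.isDomain_iff_prime _).1 hdom
    obtain ⟨P, hP, hPx⟩ := Ideal.exists_minimalPrimes_le (I := ⊥) (J := Ideal.span {x}) bot_le
    have hPp : P.IsPrime := hP.1.1
    have hPle : P ≤ Ideal.span {x} • P := by
      intro y hy
      obtain ⟨z, rfl⟩ := Ideal.mem_span_singleton'.1 (hPx hy)
      rw [mul_comm] at hy ⊢
      exact Ideal.mul_mem_mul (Ideal.mem_span_singleton_self x)
        ((hPp.mem_or_mem hy).resolve_left (hxP P hP))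
    have hP0 : P = ⊥ := Submodule.eq_bot_of_le_smul_of_le_jacobson_bot _ _
      (IsNoetherian.noetherian _) hPle (((Ideal.span_singleton_le_iff_mem _).2 hxm).trans
        (maximalIdeal_le_jacobson _))
    subst hP0
    exact IsDomain.of_bot_isPrime S

section Parameters

variable {S ι : Type*} [CommRing S] [IsLocalRing S] [Fintype ι] {x : ι → S}

/-- A regular system of parameters: generators of the maximal ideal of a Noetherian local ring,
indexed by a finite type with as many elements as the dimension. Only one inequality is required;
the other one holds by Krull's height theorem. -/
structure IsRegularSystem (x : ι → S) : Prop where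
  span_eq : Ideal.span (Set.range x) = maximalIdeal S
  card_le : (Fintype.card ι : ℕ∞) ≤ (maximalIdeal S).height

theorem IsRegularSystem.mem (hx : IsRegularSystem x) (i : ι) : x i ∈ maximalIdeal S :=
  hx.span_eq ▸ Ideal.subset_span ⟨i, rfl⟩

/-- Modulo some of the parameters one has a domain, as the quotient is again a regular local ring,
and the remaining parameters are nonzero there, as fewer than `dim S` elements cannot generate the
maximal ideal of `S`. -/
theorem IsRegularSystem.isDomain_quotient_and_notMem [IsNoetherianRing S] [DecidableEq ι]
    (hx : IsRegularSystem x) (s : Finset ι) :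
    IsDomain (S ⧸ Ideal.span (x '' s)) ∧ ∀ i ∉ s, x i ∉ Ideal.span (x '' s) := by
  classical
  have hsub : ∀ s : Finset ι, x '' s ⊆ maximalIdeal S := by
    rintro s _ ⟨i, -, rfl⟩
    exact hx.mem i
  have hcardle : ∀ s : Finset ι, (x '' (s : Set ι)).encard ≤ s.card := fun s => by
    rw [← Set.encard_coe_eq_coe_finsetCard]
    exact Set.encard_image_le _ _
  -- Krull's height theorem: two sets of parameters that together generate the maximal ideal are
  -- not too small
  have key : ∀ s t : Finset ι, Ideal.span (x '' s) ⊔ Ideal.span (x '' t) = maximalIdeal S →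
      Fintype.card ι ≤ s.card + t.card := by
    intro s t hst
    have h1 : Ideal.span (x '' (s ∪ t : Finset ι)) = maximalIdeal S := by
      rw [Finset.coe_union, Set.image_union, Ideal.span_union, hst]
    have h2 := hx.card_le.trans (Ideal.height_le_height_add_encard_of_subset _ (hsub (s ∪ t)))
    rw [h1, Ideal.map_quotient_self] at h2
    have := Ideal.Quotient.isDomain (maximalIdeal S)
    have hp0 : (⊥ : Ideal (S ⧸ maximalIdeal S)).height = 0 :=
      Ideal.height_eq_zero_iff_eq_bot.2 rfl
    rw [hp0, zero_add] at h2
    have h4 := h2.trans (hcardle _)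
    exact (by exact_mod_cast h4 : Fintype.card ι ≤ (s ∪ t).card).trans (Finset.card_union_le _ _)
  have huniv : ∀ s : Finset ι, Ideal.span (x '' s) ⊔ Ideal.span (x '' (sᶜ : Finset ι)) =
      maximalIdeal S := fun s => by
    rw [← Ideal.span_union, ← Set.image_union, ← Finset.coe_union, Finset.union_compl,
      Finset.coe_univ, Set.image_univ, hx.span_eq]
  constructor
  · have hloc := IsLocalRing.quotient_span (hsub s)
    refine IsLocalRing.isDomain_of_span_eq_maximalIdeal sᶜ.card
      (((sᶜ).image x).image (Ideal.Quotient.mk (Ideal.span (x '' s)))) ?_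
      (Finset.card_image_le.trans Finset.card_image_le) ?_
    · rw [Finset.coe_image, ← Ideal.map_span, ← IsLocalRing.map_quotientMk_maximalIdeal,
        ← huniv s, Ideal.map_sup, Ideal.map_quotient_self, bot_sup_eq, Finset.coe_image]
    · have h2 := hx.card_le.trans (Ideal.height_le_height_add_encard_of_subset _ (hsub s))
      rw [IsLocalRing.map_quotientMk_maximalIdeal] at h2
      have h3 := h2.trans (add_le_add_right (hcardle s) _)
      rw [← Finset.card_compl_add_card s, Nat.cast_add] at h3
      exact (ENat.add_le_add_iff_right (ENat.natCast_ne_top _)).1 h3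
  · intro i hi hmem
    have h1 : Ideal.span (x '' s) ⊔ Ideal.span (x '' ((sᶜ).erase i : Finset ι)) =
        maximalIdeal S := by
      refine le_antisymm ((huniv s).le.trans' (sup_le_sup_left (Ideal.span_mono
        (Set.image_mono (Finset.coe_subset.2 (Finset.erase_subset _ _)))) _)) ?_
      rw [← huniv s]
      refine sup_le le_sup_left (Ideal.span_le.2 ?_)
      rintro _ ⟨j, hj, rfl⟩
      by_cases hji : j = i
      · subst hji
        exact Ideal.mem_sup_left hmem
      · exact Ideal.mem_sup_right (Ideal.subset_span ⟨j, Finset.mem_coe.2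
          (Finset.mem_erase.2 ⟨hji, Finset.mem_coe.1 hj⟩), rfl⟩)
    have h2 := key s _ h1
    rw [Finset.card_erase_of_mem (Finset.mem_compl.2 hi), ← Finset.card_add_card_compl s] at h2
    have : 0 < (sᶜ).card := Finset.card_pos.2 ⟨i, Finset.mem_compl.2 hi⟩
    omega

/-- Distinct elements of a regular system of parameters are regular modulo powers of each other:
for `i ∉ s`, `x i` is a nonzerodivisor modulo the ideal generated by `x j ^ b j` for `j ∈ s`. -/
theorem IsRegularSystem.mem_of_mul_mem [IsNoetherianRing S] [DecidableEq ι]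
    (hx : IsRegularSystem x) (b : ι → ℕ) (s : Finset ι) {i : ι} (hi : i ∉ s) {z : S}
    (hz : x i * z ∈ Ideal.span ((fun j => x j ^ b j) '' s)) :
    z ∈ Ideal.span ((fun j => x j ^ b j) '' s) := by
  -- Split `s` into the set `t` of those `j` where the exponent is `b j` and the set `r` where it
  -- is `1`, and induct on `t`.
  suffices H : ∀ t r : Finset ι, ∀ i, i ∉ t → i ∉ r → Disjoint t r → ∀ z,
      x i * z ∈ Ideal.span ((fun j => x j ^ b j) '' t) ⊔ Ideal.span (x '' r) →
      z ∈ Ideal.span ((fun j => x j ^ b j) '' t) ⊔ Ideal.span (x '' r) by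
    simpa using H s ∅ i hi (by simp) (by simp) z (by simpa using hz)
  intro t
  induction t using Finset.induction_on with
  | empty =>
    intro r i _ hi _ z hz
    obtain ⟨hd, hn⟩ := hx.isDomain_quotient_and_notMem r
    have hp := (Ideal.Quotient.isDomain_iff_prime _).1 hd
    simp only [Finset.coe_empty, Set.image_empty, Ideal.span_empty, bot_sup_eq] at hz ⊢
    exact (hp.mem_or_mem hz).resolve_left (hn i hi)
  | insert j t hj ih =>
    intro r i hit hir hdis z hz
    set J := Ideal.span ((fun j => x j ^ b j) '' (t : Set ι)) ⊔ Ideal.span (x '' (r : Set ι))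
      with hJ
    have hji : i ≠ j := fun h => hit (h ▸ Finset.mem_insert_self _ _)
    have hit' : i ∉ t := fun h => hit (Finset.mem_insert_of_mem h)
    have hjr : j ∉ r := Finset.disjoint_left.1 hdis (Finset.mem_insert_self _ _)
    have hdis' : Disjoint t r := hdis.mono_left (Finset.subset_insert _ _)
    have hA : ∀ z, x j * z ∈ J → z ∈ J := ih r j hj hjr hdis'
    have hB : ∀ z, x i * z ∈ J ⊔ Ideal.span {x j} → z ∈ J ⊔ Ideal.span {x j} := by
      have := ih (insert j r) i hit' (by simp [hji, hir])
        (Finset.disjoint_insert_right.2 ⟨hj, hdis'⟩)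
      have he : Ideal.span (x '' (insert j r : Finset ι)) =
          Ideal.span (x '' (r : Set ι)) ⊔ Ideal.span {x j} := by
        rw [Finset.coe_insert, Set.image_insert_eq, Ideal.span_insert, sup_comm]
      rw [he, ← sup_assoc] at this
      exact this
    -- if `x i` is regular modulo `J + (x j)` and `x j` is regular modulo `J`, then `x i` is regular
    -- modulo `J + (x j ^ m)`
    have hC : ∀ m : ℕ, ∀ z, x i * z ∈ J ⊔ Ideal.span {x j ^ m} → z ∈ J ⊔ Ideal.span {x j ^ m} := by
      intro m
      induction m with
      | zero => intro z _; simp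
      | succ m ihm =>
        intro z hz
        have hle : J ⊔ Ideal.span {x j ^ (m + 1)} ≤ J ⊔ Ideal.span {x j} :=
          sup_le_sup_left (Ideal.span_singleton_le_span_singleton.2 (dvd_pow_self _ m.succ_ne_zero))
            _
        obtain ⟨v, hv, w, hw, hvw⟩ := Submodule.mem_sup.1 (hB z (hle hz))
        obtain ⟨w, rfl⟩ := Ideal.mem_span_singleton'.1 hw
        obtain ⟨v', hv', w', hw', hvw'⟩ := Submodule.mem_sup.1 hz
        obtain ⟨w', rfl⟩ := Ideal.mem_span_singleton'.1 hw'
        have h1 : x j * (x i * w - w' * x j ^ m) ∈ J := by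
          have : x j * (x i * w - w' * x j ^ m) = v' - x i * v := by
            have e1 := congrArg (x i * ·) hvw
            rw [← hvw'] at e1
            linear_combination e1
          rw [this]
          exact sub_mem hv' (Ideal.mul_mem_left _ _ hv)
        have h2 : x i * w ∈ J ⊔ Ideal.span {x j ^ m} :=
          Submodule.mem_sup.2 ⟨_, hA _ h1, w' * x j ^ m, Ideal.mem_span_singleton'.2 ⟨w', rfl⟩,
            by ring⟩
        obtain ⟨v'', hv'', w'', hw'', hvw''⟩ := Submodule.mem_sup.1 (ihm w h2)
        obtain ⟨w'', rfl⟩ := Ideal.mem_span_singleton'.1 hw''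
        refine Submodule.mem_sup.2 ⟨v + v'' * x j, add_mem hv (Ideal.mul_mem_right _ _ hv''),
          w'' * x j ^ (m + 1), Ideal.mem_span_singleton'.2 ⟨w'', rfl⟩, ?_⟩
        rw [← hvw, ← hvw'']
        ring
    have he : Ideal.span ((fun j => x j ^ b j) '' (insert j t : Finset ι)) ⊔
        Ideal.span (x '' (r : Set ι)) = J ⊔ Ideal.span {x j ^ b j} := by
      rw [Finset.coe_insert, Set.image_insert_eq, Ideal.span_insert, sup_assoc, sup_comm]
    rw [he] at hz ⊢
    exact hC _ z hz

theorem IsRegularLocalRing.exists_isRegularSystem (S : Type*) [CommRing S] [IsRegularLocalRing S]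
    {h : ℕ} (hh : (maximalIdeal S).height = h) : ∃ x : Fin h → S, IsRegularSystem x := by
  have hfg := (maximalIdeal S).fg_of_isNoetherianRing
  have hcard : (maximalIdeal S).generators.ncard = h := by
    have h1 := IsRegularLocalRing.spanFinrank_maximalIdeal (R := S)
    rw [← maximalIdeal_height_eq_ringKrullDim, hh] at h1
    rw [Submodule.FG.generators_ncard hfg]
    exact_mod_cast h1
  have hfin := Submodule.FG.finite_generators hfg
  have := hfin.to_subtype
  let e : Fin h ≃ (maximalIdeal S).generators := (Finite.equivFinOfCardEq hcard).symm
  refine ⟨fun i => e i, ⟨?_, by simp [hh]⟩⟩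
  have : Set.range (fun i => (e i : S)) = (maximalIdeal S).generators := by
    rw [Set.range_comp' Subtype.val e, e.surjective.range_eq, Set.image_univ, Subtype.range_val]
  rw [this]
  exact Submodule.span_generators _

end Parameters

end

section

open IsLocalRing Finset SymbolicFPure

/-! ### Monomials in a regular system of parameters -/

section Monomials

variable {S ι : Type*} [CommRing S] [Fintype ι]

/-- The monomial `∏ i, x i ^ a i` in a family of ring elements. -/
def paramMonomial (x : ι → S) (a : ι → ℕ) : S := ∏ i, x i ^ a i

theorem paramMonomial_add (x : ι → S) (a b : ι → ℕ) :
    paramMonomial x (a + b) = paramMonomial x a * paramMonomial x b := by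
  simp [paramMonomial, pow_add, Finset.prod_mul_distrib]

theorem paramMonomial_nsmul (x : ι → S) (n : ℕ) (a : ι → ℕ) :
    paramMonomial x (n • a) = paramMonomial x a ^ n := by
  simp [paramMonomial, mul_comm n, pow_mul, Finset.prod_pow]

theorem paramMonomial_mem_of_le (x : ι → S) {a b : ι → ℕ} (h : b ≤ a) {J : Ideal S}
    (hb : paramMonomial x b ∈ J) : paramMonomial x a ∈ J := by
  rw [← tsub_add_cancel_of_le h, paramMonomial_add]
  exact J.mul_mem_left _ hb

theorem paramMonomial_single [DecidableEq ι] (x : ι → S) (i : ι) (n : ℕ) :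
    paramMonomial x (Pi.single i n) = x i ^ n := by
  rw [paramMonomial, Finset.prod_eq_single i]
  · simp
  · intro j _ hj
    simp [hj]
  · simp

theorem span_range_pow_eq_span_paramMonomial (x : ι → S) (n : ℕ) :
    Ideal.span (Set.range x) ^ n = Ideal.span (paramMonomial x '' {a | ∑ i, a i = n}) := by
  classical
  induction n with
  | zero =>
    symm
    rw [pow_zero, Ideal.one_eq_top, Ideal.eq_top_iff_one]
    exact Ideal.subset_span ⟨0, by simp, by simp [paramMonomial]⟩
  | succ n ih =>
    rw [pow_succ, ih, Ideal.span_mul_span']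
    apply le_antisymm
    · rw [Ideal.span_le]
      rintro _ ⟨_, ⟨a, ha, rfl⟩, _, ⟨i, rfl⟩, rfl⟩
      refine Ideal.subset_span ⟨a + Pi.single i 1, ?_, ?_⟩
      · simp [Finset.sum_add_distrib, show ∑ i, a i = n from ha]
      · simp [paramMonomial_add, paramMonomial_single]
    · rw [Ideal.span_le]
      rintro _ ⟨a, ha, rfl⟩
      obtain ⟨i, hi⟩ : ∃ i, a i ≠ 0 := by
        by_contra! h
        simp [h] at ha
      have hle : Pi.single i 1 ≤ a := by
        intro j
        by_cases hj : j = i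
        · subst hj; simpa using Nat.one_le_iff_ne_zero.2 hi
        · simp [hj]
      have he : a - Pi.single i 1 + Pi.single i 1 = a := tsub_add_cancel_of_le hle
      refine Ideal.subset_span ⟨_, ⟨a - Pi.single i 1, ?_, rfl⟩, x i, ⟨i, rfl⟩, ?_⟩
      · have h1 := congrArg (fun c : ι → ℕ => ∑ i, c i) he
        simp only [Pi.add_apply, Finset.sum_add_distrib, Finset.sum_pi_single', Finset.mem_univ,
          if_true] at h1
        have ha' : ∑ i, a i = n + 1 := ha
        change ∑ j, (a - Pi.single i 1 : ι → ℕ) j = n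
        omega
      · have : x i = paramMonomial x (Pi.single i 1) := by simp [paramMonomial_single]
        simp only [this]
        rw [← paramMonomial_add, he]

theorem paramMonomial_mem_pow (x : ι → S) {a : ι → ℕ} {n : ℕ} (h : n ≤ ∑ i, a i) :
    paramMonomial x a ∈ Ideal.span (Set.range x) ^ n := by
  refine Ideal.pow_le_pow_right h ?_
  rw [span_range_pow_eq_span_paramMonomial]
  exact Ideal.subset_span ⟨a, rfl, rfl⟩

variable {x : ι → S} [IsLocalRing S]

/-- The monomial theorem for a regular system of parameters `x`: the monomial `x ^ a` is not in the
ideal generated by the powers `x i ^ (a i + 1)`. The factors `x i ^ a i` can be cancelled one by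
one, as `x i` is regular modulo the powers of the other parameters. -/
theorem IsRegularSystem.paramMonomial_notMem [IsNoetherianRing S] (hx : IsRegularSystem x)
    (a : ι → ℕ) :
    paramMonomial x a ∉ Ideal.span (Set.range fun i => x i ^ (a i + 1)) := by
  classical
  suffices H : ∀ s : Finset ι, ∏ i ∈ s, x i ^ a i ∉
      Ideal.span ((fun j => x j ^ (if j ∈ s then a j + 1 else 1)) '' (univ : Finset ι)) by
    simpa [paramMonomial] using H univ
  intro s
  induction s using Finset.induction_on with
  | empty =>
    simp only [Finset.prod_empty, Finset.notMem_empty, if_false, pow_one, Finset.coe_univ,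
      Set.image_univ]
    rw [hx.span_eq]
    exact fun h => (maximalIdeal.isMaximal S).ne_top ((Ideal.eq_top_iff_one _).2 h)
  | insert j s hj ih =>
    intro hmem
    rw [Finset.prod_insert hj] at hmem
    set b : ι → ℕ := fun j => if j ∈ s then a j + 1 else 1 with hb
    set K := Ideal.span ((fun j => x j ^ b j) '' (univ.erase j : Finset ι)) with hK
    have h1 : Ideal.span ((fun i => x i ^ (if i ∈ insert j s then a i + 1 else 1)) ''
        (univ : Finset ι)) = Ideal.span {x j ^ (a j + 1)} ⊔ K := by
      rw [← Finset.insert_erase (Finset.mem_univ j), Finset.coe_insert, Set.image_insert_eq,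
        Ideal.span_insert]
      congr 2
      · simp
      · refine Set.image_congr fun i hi => ?_
        have : i ≠ j := by simpa using hi
        simp [hb, this]
    have h2 : Ideal.span ((fun i => x i ^ b i) '' (univ : Finset ι)) = Ideal.span {x j} ⊔ K := by
      rw [← Finset.insert_erase (Finset.mem_univ j), Finset.coe_insert, Set.image_insert_eq,
        Ideal.span_insert]
      simp [hb, hj, hK]
    have hreg : ∀ n z, x j ^ n * z ∈ K → z ∈ K := by
      intro n
      induction n with
      | zero => intro z hz; simpa using hz
      | succ n ihn =>
        intro z hz
        rw [pow_succ, mul_assoc] at hz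
        exact hx.mem_of_mul_mem b _ (Finset.notMem_erase j univ) (ihn _ hz)
    rw [h1] at hmem
    obtain ⟨u, hu, v, hv, huv⟩ := Submodule.mem_sup.1 hmem
    obtain ⟨u, rfl⟩ := Ideal.mem_span_singleton'.1 hu
    refine ih (h2 ▸ Submodule.mem_sup.2 ⟨u * x j, Ideal.mem_span_singleton'.2 ⟨u, rfl⟩,
      ∏ i ∈ s, x i ^ a i - u * x j, hreg (a j) _ ?_, by ring⟩)
    have : x j ^ a j * (∏ i ∈ s, x i ^ a i - u * x j) = v := by
      linear_combination -huv
    rwa [this]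

/-- Modulo a power of the maximal ideal, every element is a combination of finitely many distinct
monomials in the parameters with unit coefficients. -/
theorem IsRegularSystem.exists_expansion (hx : IsRegularSystem x) (f : S) (M : ℕ) :
    ∃ (A : Finset (ι → ℕ)) (u : (ι → ℕ) → S), (∀ a ∈ A, IsUnit (u a) ∧ ∑ i, a i < M) ∧
      f - ∑ a ∈ A, u a * paramMonomial x a ∈ maximalIdeal S ^ M := by
  classical
  induction M with
  | zero => exact ⟨∅, 0, by simp, by simp⟩
  | succ M ih =>
    obtain ⟨A, u, hA, hf⟩ := ih
    have hf' := hf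
    rw [← hx.span_eq, span_range_pow_eq_span_paramMonomial] at hf'
    have hT : {a : ι → ℕ | ∑ i, a i = M} = (Finset.piAntidiag univ M : Finset (ι → ℕ)) := by
      ext; simp
    rw [hT] at hf'
    obtain ⟨c, hc⟩ := (Submodule.mem_span_image_finset_iff_exists_fun' S).1 hf'
    set B := (Finset.piAntidiag univ M).filter fun a => IsUnit (c a) with hB
    have hBmem : ∀ a, a ∈ B ↔ ∑ i, a i = M ∧ IsUnit (c a) := by
      intro a; simp [hB]
    have hdis : Disjoint A B := Finset.disjoint_left.2 fun a ha hb => by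
      have h1 := (hA a ha).2
      have h2 := ((hBmem a).1 hb).1
      omega
    refine ⟨A ∪ B, fun a => if a ∈ A then u a else c a, ?_, ?_⟩
    · intro a ha
      by_cases haA : a ∈ A
      · simpa [haA] using ⟨(hA a haA).1, (hA a haA).2.le⟩
      · have := (hBmem a).1 ((Finset.mem_union.1 ha).resolve_left haA)
        simpa [haA] using ⟨this.2, by omega⟩
    · have e1 : ∑ a ∈ A, (if a ∈ A then u a else c a) * paramMonomial x a =
          ∑ a ∈ A, u a * paramMonomial x a := Finset.sum_congr rfl fun a ha => by simp [ha]
      have e2 : ∑ a ∈ B, (if a ∈ A then u a else c a) * paramMonomial x a =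
          ∑ a ∈ B, c a * paramMonomial x a := Finset.sum_congr rfl fun a ha => by
        simp [Finset.disjoint_right.1 hdis ha]
      rw [Finset.sum_union hdis, e1, e2, ← sub_sub, ← hc, ← Finset.sum_filter_add_sum_filter_not
        (Finset.piAntidiag univ M) (fun a => IsUnit (c a))]
      simp only [smul_eq_mul]
      rw [add_sub_cancel_left]
      refine Ideal.sum_mem _ fun a ha => ?_
      rw [Finset.mem_filter, Finset.mem_piAntidiag] at ha
      rw [pow_succ']
      refine Ideal.mul_mem_mul ((mem_maximalIdeal _).2 ha.2) ?_
      rw [← hx.span_eq]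
      exact paramMonomial_mem_pow x ha.1.1.ge

/-- If a combination of distinct monomials in the parameters, with unit coefficients, lies in an
ideal generated by monomials, then so does every one of them, in the sense of exponents. A minimal
exponent `a` violating this would put `x ^ a` into the ideal generated by the `x i ^ (a i + 1)`. -/
theorem IsRegularSystem.exists_le_of_sum_mem [IsNoetherianRing S] (hx : IsRegularSystem x)
    (A : Finset (ι → ℕ)) (u : (ι → ℕ) → S) (hu : ∀ a ∈ A, IsUnit (u a)) (B : Set (ι → ℕ))
    (h : ∑ a ∈ A, u a * paramMonomial x a ∈ Ideal.span (paramMonomial x '' B)) :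
    ∀ a ∈ A, ∃ b ∈ B, b ≤ a := by
  classical
  by_contra! hcon
  obtain ⟨a₀, ha₀, ha₀B⟩ := hcon
  obtain ⟨a, ha⟩ := (A.filter fun a => ∀ b ∈ B, ¬ b ≤ a).exists_minimal
    ⟨a₀, Finset.mem_filter.2 ⟨ha₀, ha₀B⟩⟩
  have haA := (Finset.mem_filter.1 ha.1).1
  have haB := (Finset.mem_filter.1 ha.1).2
  have hgen : ∀ e : ι → ℕ, ¬ e ≤ a →
      paramMonomial x e ∈ Ideal.span (Set.range fun i => x i ^ (a i + 1)) := by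
    intro e he
    obtain ⟨i, hi⟩ : ∃ i, a i < e i := by simpa [Pi.le_def] using he
    refine paramMonomial_mem_of_le x (b := Pi.single i (a i + 1)) ?_ ?_
    · intro j
      by_cases hj : j = i
      · subst hj; simpa using hi
      · simp [hj]
    · rw [paramMonomial_single]
      exact Ideal.subset_span ⟨i, rfl⟩
  refine hx.paramMonomial_notMem a ((Ideal.unit_mul_mem_iff_mem _ (hu a haA)).1 ?_)
  rw [← Finset.add_sum_erase A _ haA] at h
  have h1 : Ideal.span (paramMonomial x '' B) ≤
      Ideal.span (Set.range fun i => x i ^ (a i + 1)) := by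
    rw [Ideal.span_le]
    rintro _ ⟨b, hb, rfl⟩
    exact hgen b (haB b hb)
  have h2 : ∑ e ∈ A.erase a, u e * paramMonomial x e ∈
      Ideal.span (Set.range fun i => x i ^ (a i + 1)) := by
    refine Ideal.sum_mem _ fun e he => Ideal.mul_mem_left _ _ (hgen e fun hle => ?_)
    obtain ⟨hne, heA⟩ := Finset.mem_erase.1 he
    by_cases heB : ∀ b ∈ B, ¬ b ≤ e
    · exact hne (le_antisymm hle (ha.2 (Finset.mem_filter.2 ⟨heA, heB⟩) hle))
    · push Not at heB
      obtain ⟨b, hb, hbe⟩ := heB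
      exact haB b hb (hbe.trans hle)
  exact (Ideal.add_mem_iff_left _ h2).1 (h1 h)

end Monomials

end

section

open IsLocalRing Finset SymbolicFPure

/-! ### Frobenius powers and powers of the maximal ideal -/

namespace SymbolicFPure

theorem frobeniusPower_eq_map {S : Type*} [CommRing S] (p : ℕ) [ExpChar S p] (J : Ideal S) :
    frobeniusPower p J = J.map (frobenius S p) := rfl

theorem frobeniusPower_span {S : Type*} [CommRing S] (p : ℕ) [ExpChar S p] (s : Set S) :
    frobeniusPower p (Ideal.span s) = Ideal.span ((fun x => x ^ p) '' s) := by
  rw [frobeniusPower_eq_map, Ideal.map_span]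
  rfl

end SymbolicFPure

section LocalColon

variable {S ι : Type*} [CommRing S] [Fintype ι] {x : ι → S} {p : ℕ} [hp : Fact p.Prime]

/-- Pigeonhole: a monomial of degree `> n p + h (p - 1)` in `h` variables is divisible by the
`p`-th power of a monomial of degree `n + 1`. -/
theorem span_range_pow_le_frobeniusPower (x : ι → S) (n : ℕ) :
    Ideal.span (Set.range x) ^ (Fintype.card ι * (p - 1) + (n * p + 1)) ≤
      frobeniusPower p (Ideal.span (Set.range x) ^ (n + 1)) := by
  rw [span_range_pow_eq_span_paramMonomial, Ideal.span_le]
  rintro _ ⟨a, ha, rfl⟩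
  have ha' : ∑ i, a i = Fintype.card ι * (p - 1) + (n * p + 1) := ha
  have hpos := hp.out.pos
  refine paramMonomial_mem_of_le x (b := p • fun i => a i / p) (fun i => ?_) ?_
  · simpa using Nat.mul_div_le (a i) p
  · rw [paramMonomial_nsmul]
    refine Ideal.subset_span ⟨_, paramMonomial_mem_pow x ?_, rfl⟩
    have h1 : ∑ i, a i ≤ ∑ i, (p * (a i / p) + (p - 1)) := Finset.sum_le_sum fun i _ => by
      have := Nat.div_add_mod (a i) p
      have := Nat.mod_lt (a i) hpos
      omega
    rw [Finset.sum_add_distrib, ← Finset.mul_sum, ha', Finset.sum_const, Finset.card_univ,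
      smul_eq_mul] at h1
    have h2 : p * n < p * ∑ i, a i / p := by
      rw [mul_comm p n]; omega
    exact Nat.lt_of_mul_lt_mul_left h2

/-- An exponent vector of degree `< h (p - 1) ≤ p (N + 1)` lies below one of the form
`p c + (p - 1, …, p - 1)` with `c` of degree `N`. -/
theorem exists_le_mul_add_of_sum_lt {a : ι → ℕ} {N : ℕ}
    (hN : Fintype.card ι * (p - 1) ≤ p * (N + 1)) (ha : ∑ i, a i < Fintype.card ι * (p - 1)) :
    ∃ c : ι → ℕ, ∑ i, c i = N ∧ ∀ i, a i ≤ p * c i + (p - 1) := by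
  classical
  have hpos := hp.out.pos
  obtain ⟨i₀⟩ : Nonempty ι := by
    by_contra h
    rw [not_nonempty_iff] at h
    simp at ha
  have he : ∑ i, a i / p ≤ N := by
    have h1 : p * ∑ i, a i / p ≤ ∑ i, a i := by
      rw [Finset.mul_sum]
      exact Finset.sum_le_sum fun i _ => Nat.mul_div_le _ _
    exact Nat.lt_succ_iff.1 (Nat.lt_of_mul_lt_mul_left (h1.trans_lt (ha.trans_le hN)))
  refine ⟨fun i => a i / p + Pi.single (M := fun _ => ℕ) i₀ (N - ∑ i, a i / p) i, ?_, fun i => ?_⟩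
  · rw [Finset.sum_add_distrib, Finset.sum_pi_single']
    simp only [Finset.mem_univ, if_true]
    omega
  · have h1 := Nat.div_add_mod (a i) p
    have h2 := Nat.mod_lt (a i) hpos
    rw [mul_add]
    omega

variable [IsLocalRing S] [IsNoetherianRing S] [CharP S p]

/-- In a regular local ring of dimension `h` with maximal ideal `𝔫`, the colon ideal
`((𝔫 ^ (N + 1))^[p] : 𝔫 ^ (N p + 1))` is contained in `𝔫 ^ (h (p - 1))` as soon as
`h (p - 1) ≤ p (N + 1)`. -/
theorem IsRegularSystem.mem_pow_of_forall_mul_mem (hx : IsRegularSystem x) {N : ℕ}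
    (hN : Fintype.card ι * (p - 1) ≤ p * (N + 1)) {f : S}
    (hf : ∀ y ∈ maximalIdeal S ^ (N * p + 1), f * y ∈ frobeniusPower p (maximalIdeal S ^ (N + 1))) :
    f ∈ maximalIdeal S ^ (Fintype.card ι * (p - 1)) := by
  classical
  have : ExpChar S p := ExpChar.prime hp.out
  have hpos := hp.out.pos
  obtain ⟨A, u, hA, hfA⟩ := hx.exists_expansion f (Fintype.card ι * (p - 1))
  rcases A.eq_empty_or_nonempty with rfl | ⟨a, ha⟩
  · simpa using hfA
  exfalso
  obtain ⟨c, hcN, hac⟩ := exists_le_mul_add_of_sum_lt hN (hA a ha).2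
  -- the monomial to multiply with moves `a` just below the next multiples of `p`
  set b : ι → ℕ := fun i => p * c i + (p - 1) - a i with hb
  have hab : ∀ i, a i + b i = p * c i + (p - 1) := fun i => Nat.add_sub_cancel' (hac i)
  have hdeg : N * p + 1 ≤ ∑ i, b i := by
    have h1 : ∑ i, a i + ∑ i, b i = p * N + Fintype.card ι * (p - 1) := by
      rw [← Finset.sum_add_distrib, Finset.sum_congr rfl fun i _ => hab i, Finset.sum_add_distrib,
        ← Finset.mul_sum, hcN, Finset.sum_const, Finset.card_univ, smul_eq_mul]
    have := (hA a ha).2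
    rw [mul_comm N p]
    omega
  have hbm : paramMonomial x b ∈ maximalIdeal S ^ (N * p + 1) :=
    hx.span_eq ▸ paramMonomial_mem_pow x hdeg
  have h2 : (∑ a ∈ A, u a * paramMonomial x a) * paramMonomial x b ∈
      frobeniusPower p (maximalIdeal S ^ (N + 1)) := by
    have h3 : (f - ∑ a ∈ A, u a * paramMonomial x a) * paramMonomial x b ∈
        frobeniusPower p (maximalIdeal S ^ (N + 1)) := by
      have := span_range_pow_le_frobeniusPower (p := p) x N
      rw [hx.span_eq] at this
      refine this ?_
      rw [pow_add]
      exact Ideal.mul_mem_mul hfA hbm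
    have := sub_mem (hf _ hbm) h3
    rwa [← sub_mul, sub_sub_cancel] at this
  have h4 : frobeniusPower p (maximalIdeal S ^ (N + 1)) =
      Ideal.span (paramMonomial x '' ((fun c => p • c) '' {c | ∑ i, c i = N + 1})) := by
    rw [← hx.span_eq, span_range_pow_eq_span_paramMonomial, frobeniusPower_span, Set.image_image,
      Set.image_image]
    simp_rw [paramMonomial_nsmul]
  rw [h4, Finset.sum_mul] at h2
  have h5 : ∑ a ∈ A, u a * paramMonomial x a * paramMonomial x b =
      ∑ e ∈ A.map (addRightEmbedding b), u (e - b) * paramMonomial x e := by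
    rw [Finset.sum_map]
    refine Finset.sum_congr rfl fun e _ => ?_
    simp [paramMonomial_add, mul_assoc]
  rw [h5] at h2
  obtain ⟨_, ⟨c', hc', rfl⟩, hle⟩ := hx.exists_le_of_sum_mem _ (fun e => u (e - b)) (by
    intro e he
    obtain ⟨a', ha', rfl⟩ := Finset.mem_map.1 he
    simpa using (hA a' ha').1) _ h2 (a + b) (Finset.mem_map.2 ⟨a, ha, rfl⟩)
  have h6 : ∑ i, c' i ≤ ∑ i, c i := Finset.sum_le_sum fun i _ => by
    have h7 : p * c' i ≤ p * c i + (p - 1) := by simpa [hab i] using hle i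
    have h8 : p * c' i < p * (c i + 1) := by rw [mul_add]; omega
    exact Nat.lt_succ_iff.1 (Nat.lt_of_mul_lt_mul_left h8)
  rw [hcN, show ∑ i, c' i = N + 1 from hc'] at h6
  omega

end LocalColon

end

section

open IsLocalRing Finset SymbolicFPure

/-! ### Freeness of the Frobenius pushforward -/

/-- A finite module over a Noetherian local ring on which a sequence generating the maximal ideal
is regular is free. -/
theorem IsLocalRing.free_of_isWeaklyRegular {S : Type*} [CommRing S] [IsLocalRing S]
    [IsNoetherianRing S] {M : Type*} [AddCommGroup M] [Module S M] [Module.Finite S M]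
    {l : List S} (hl : Ideal.ofList l = maximalIdeal S)
    (hM : RingTheory.Sequence.IsWeaklyRegular M l) : Module.Free S M := by
  induction h : l.length generalizing S M l with
  | zero =>
    obtain rfl := List.length_eq_zero_iff.1 h
    rw [Ideal.ofList_nil] at hl
    let := (isField_iff_maximalIdeal_eq.2 hl.symm).toField
    exact Module.Free.of_divisionRing S M
  | succ n ih =>
    obtain ⟨y, l, rfl⟩ := List.exists_cons_of_length_eq_add_one h
    rw [RingTheory.Sequence.isWeaklyRegular_cons_iff'] at hM
    have hy : y ∈ maximalIdeal S := hl ▸ Ideal.subset_span (by simp)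
    have hloc : IsLocalRing (S ⧸ Ideal.span {y}) :=
      IsLocalRing.quotient_span (Set.singleton_subset_iff.2 hy)
    have hfin : Module.Finite (S ⧸ Ideal.span {y}) (QuotSMulTop y M) :=
      Module.Finite.of_restrictScalars_finite S _ _
    have hfp : Module.FinitePresentation S M := Module.finitePresentation_of_finite S M
    rw [← Module.free_quotSMulTop_iff_free S M (maximalIdeal_le_jacobson _ hy) hM.1]
    refine ih ?_ hM.2 (by simpa using h)
    rw [← Ideal.map_ofList, ← IsLocalRing.map_quotientMk_maximalIdeal, ← hl, Ideal.ofList_cons,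
      Ideal.map_sup, Ideal.map_quotient_self, bot_sup_eq]

/-- The ring `S` as a module over itself through the Frobenius endomorphism: a model of the
`S`-module `S^{1/p}`. -/
def FrobeniusModule (_p : ℕ) (S : Type*) : Type _ := S

namespace FrobeniusModule

variable (p : ℕ) {S : Type*} [CommRing S]

instance : AddCommGroup (FrobeniusModule p S) := inferInstanceAs (AddCommGroup S)

/-- The identity map from `S` to its Frobenius pushforward. -/
def of : S ≃+ FrobeniusModule p S := AddEquiv.refl S

variable [ExpChar S p]

instance : Module S (FrobeniusModule p S) :=
  letI : Module S (FrobeniusModule p S) := inferInstanceAs (Module S S)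
  Module.compHom (FrobeniusModule p S) (frobenius S p)

theorem smul_of (r y : S) : r • of p y = of p (r ^ p * y) := rfl

theorem finite (h : (frobenius S p).Finite) : Module.Finite S (FrobeniusModule p S) := h

theorem of_mem_smul_top {J : Ideal S} {y : S} :
    of p y ∈ J • (⊤ : Submodule S (FrobeniusModule p S)) ↔ y ∈ frobeniusPower p J := by
  constructor
  · intro h
    suffices H : ∀ z ∈ J • (⊤ : Submodule S (FrobeniusModule p S)),
        (of p).symm z ∈ frobeniusPower p J from H _ h
    intro z hz
    refine Submodule.smul_induction_on hz (fun r hr n _ => ?_) fun a b ha hb => ?_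
    · obtain ⟨n, rfl⟩ := (of p).surjective n
      rw [smul_of, AddEquiv.symm_apply_apply]
      exact Ideal.mul_mem_right _ _ (Ideal.subset_span ⟨r, hr, rfl⟩)
    · rw [map_add]
      exact add_mem ha hb
  · intro h
    refine Submodule.span_induction (p := fun y _ =>
      of p y ∈ J • (⊤ : Submodule S (FrobeniusModule p S))) ?_ (by rw [map_zero]; exact zero_mem _)
      (fun a b _ _ ha hb => by rw [map_add]; exact add_mem ha hb) ?_ h
    · rintro _ ⟨r, hr, rfl⟩
      have : of p (r ^ p) = r • of p 1 := by rw [smul_of, mul_one]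
      change of p (r ^ p) ∈ _
      rw [this]
      exact Submodule.smul_mem_smul hr trivial
    · intro a y _ hy
      refine Submodule.smul_induction_on (p := fun z => of p (a * (of p).symm z) ∈
        J • (⊤ : Submodule S (FrobeniusModule p S))) hy (fun r hr n _ => ?_) fun y z hy hz => ?_
      · obtain ⟨n, rfl⟩ := (of p).surjective n
        have : of p (a * (of p).symm (r • of p n)) = r • of p (a * n) := by
          rw [smul_of, smul_of, AddEquiv.symm_apply_apply, mul_left_comm]
        rw [this]
        exact Submodule.smul_mem_smul hr trivial
      · rw [map_add, mul_add, map_add]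
        exact add_mem hy hz

end FrobeniusModule

/-- The easy half of Kunz's theorem: over an `F`-finite regular local ring the Frobenius
pushforward is free. -/
theorem IsRegularSystem.free_frobeniusModule {S : Type*} [CommRing S] [IsLocalRing S]
    [IsNoetherianRing S] {n : ℕ} {x : Fin n → S} (hx : IsRegularSystem x) (p : ℕ) [ExpChar S p]
    (hF : (frobenius S p).Finite) : Module.Free S (FrobeniusModule p S) := by
  classical
  have := FrobeniusModule.finite p hF
  refine IsLocalRing.free_of_isWeaklyRegular (l := List.ofFn x) ?_ ⟨fun i hi => ?_⟩
  · rw [← hx.span_eq]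
    refine congrArg Ideal.span ?_
    ext y
    simp
  · rw [isSMulRegular_quotient_iff_mem_of_smul_mem]
    intro y hy
    obtain ⟨y, rfl⟩ := (FrobeniusModule.of p).surjective y
    rw [FrobeniusModule.smul_of, FrobeniusModule.of_mem_smul_top] at hy
    rw [FrobeniusModule.of_mem_smul_top]
    have hi' : i < n := by simpa using hi
    set s : Finset (Fin n) := univ.filter fun j => (j : ℕ) < i
    have he : frobeniusPower p (Ideal.ofList ((List.ofFn x).take i)) =
        Ideal.span ((fun j => x j ^ p) '' (s : Set (Fin n))) := by
      rw [Ideal.ofList, frobeniusPower_span, ← Set.image_image (fun y => y ^ p) x]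
      congr 2
      ext y
      simp only [Set.mem_ofPred_eq, List.mem_take_iff_getElem, List.getElem_ofFn, Set.mem_image,
        Finset.mem_coe]
      constructor
      · rintro ⟨j, hj, rfl⟩
        have hj' : j < i ∧ j < n := by simpa using hj
        exact ⟨⟨j, hj'.2⟩, by simpa [s] using hj'.1, rfl⟩
      · rintro ⟨j, hj, rfl⟩
        exact ⟨j, by simpa [s] using hj, rfl⟩
    rw [he, List.getElem_ofFn] at hy
    rw [he]
    have hreg : ∀ m z, x ⟨i, hi'⟩ ^ m * z ∈ Ideal.span ((fun j => x j ^ p) '' (s : Set (Fin n))) →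
        z ∈ Ideal.span ((fun j => x j ^ p) '' (s : Set (Fin n))) := by
      intro m
      induction m with
      | zero => intro z hz; simpa using hz
      | succ m ih =>
        intro z hz
        rw [pow_succ, mul_assoc] at hz
        exact hx.mem_of_mul_mem (fun _ => p) s (by simp [s]) (ih _ hz)
    exact hreg p y hy

/-! ### Dual bases for Frobenius -/

/-- A `p⁻¹`-linear map `Φ : R^{1/p} → R`, together with dual bases `b`, `c` of `R^{1/p}` over `R`
for the pairing `(y, z) ↦ Φ (y z)`. For such a `Φ` the maps `R^{1/p} → R` are precisely the
maps `Φ (f ·)`. -/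
structure IsFrobeniusDualBasis {R ι : Type*} [CommRing R] [Fintype ι] (p : ℕ) (Φ : R →+ R)
    (b c : ι → R) : Prop where
  map_pow_mul : ∀ r x : R, Φ (r ^ p * x) = r * Φ x
  sum_eq : ∀ y : R, ∑ i, Φ (b i * y) ^ p * c i = y

namespace IsFrobeniusDualBasis

variable {R ι : Type*} [CommRing R] [Fintype ι] {p : ℕ} {Φ : R →+ R} {b c : ι → R}

theorem mem_frobeniusPower (h : IsFrobeniusDualBasis p Φ b c) {J : Ideal R} {y : R}
    (hy : ∀ r, Φ (r * y) ∈ J) : y ∈ frobeniusPower p J := by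
  rw [← h.sum_eq y]
  exact Ideal.sum_mem _ fun i _ => Ideal.mul_mem_right _ _ (Ideal.subset_span ⟨_, hy (b i), rfl⟩)

theorem map_mem_of_mem_frobeniusPower {φ : R →+ R} (hφ : ∀ r x : R, φ (r ^ p * x) = r * φ x)
    {J : Ideal R} {y : R} (hy : y ∈ frobeniusPower p J) : φ y ∈ J := by
  suffices H : ∀ r, φ (r * y) ∈ J by simpa using H 1
  refine Submodule.span_induction (p := fun y _ => ∀ r, φ (r * y) ∈ J) ?_ ?_ ?_ ?_ hy
  · rintro _ ⟨z, hz, rfl⟩ r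
    rw [mul_comm, hφ]
    exact J.mul_mem_right _ hz
  · simp
  · intro a b _ _ ha hb r
    rw [mul_add, map_add]
    exact add_mem (ha r) (hb r)
  · intro a y _ hy r
    rw [smul_eq_mul, ← mul_assoc]
    exact hy _

theorem exists_eq_mul (h : IsFrobeniusDualBasis p Φ b c) {φ : R →+ R}
    (hφ : ∀ r x : R, φ (r ^ p * x) = r * φ x) : ∃ f, ∀ y, φ y = Φ (f * y) := by
  refine ⟨∑ i, φ (c i) ^ p * b i, fun y => ?_⟩
  rw [Finset.sum_mul, map_sum]
  conv_lhs => rw [← h.sum_eq y, map_sum]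
  refine Finset.sum_congr rfl fun i _ => ?_
  rw [hφ, mul_assoc, h.map_pow_mul, mul_comm]

end IsFrobeniusDualBasis

/-- Duality for Frobenius on an `F`-finite regular local ring. As `Φ` one takes a coordinate of
`S^{1/p}` for which `Φ (∏ i, x i ^ (p - 1))` is a unit. As this product generates the socle modulo
`𝔫^[p]`, the pairing `(y, z) ↦ Φ (y z)` is nondegenerate modulo `𝔫`, so its Gram matrix is
invertible. -/
theorem IsRegularSystem.exists_isFrobeniusDualBasis {S : Type*} [CommRing S] [IsLocalRing S]
    [IsNoetherianRing S] {n : ℕ} {x : Fin n → S} (hx : IsRegularSystem x) (p : ℕ)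
    [hp : Fact p.Prime] [CharP S p] (hF : (frobenius S p).Finite) :
    ∃ (m : ℕ) (Φ : S →+ S) (b c : Fin m → S), IsFrobeniusDualBasis p Φ b c := by
  classical
  have : ExpChar S p := ExpChar.prime hp.out
  have hp1 : p - 1 + 1 = p := Nat.sub_add_cancel hp.out.one_le
  have hfin := FrobeniusModule.finite p hF
  have hfree := hx.free_frobeniusModule p hF
  let B := Module.finBasis S (FrobeniusModule p S)
  let o := FrobeniusModule.of p (S := S)
  let c : Fin _ → S := fun i => o.symm (B i)
  have hB : ∀ y : S, ∑ i, B.repr (o y) i ^ p * c i = y := fun y => by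
    have := congrArg o.symm (B.sum_repr (o y))
    rw [map_sum, AddEquiv.symm_apply_apply] at this
    exact this
  let ψ : Fin (Module.finrank S (FrobeniusModule p S)) → S →+ S := fun i =>
    ((B.coord i).toAddMonoidHom).comp o.toAddMonoidHom
  have hψ : ∀ i, ∀ r y : S, ψ i (r ^ p * y) = r * ψ i y := fun i r y =>
    (B.coord i).map_smul r (o y)
  have hmem : ∀ y : S, (∀ i, B.repr (o y) i ∈ maximalIdeal S) →
      y ∈ frobeniusPower p (maximalIdeal S) := fun y hy => by
    rw [← hB y]
    exact Ideal.sum_mem _ fun i _ => Ideal.mul_mem_right _ _ (Ideal.subset_span ⟨_, hy i, rfl⟩)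
  have hfrob : frobeniusPower p (maximalIdeal S) = Ideal.span (Set.range fun i => x i ^ p) := by
    rw [← hx.span_eq, frobeniusPower_span, ← Set.range_comp]
    rfl
  -- the coordinate `Φ`
  obtain ⟨i₀, hi₀⟩ : ∃ i, B.repr (o (paramMonomial x fun _ => p - 1)) i ∉ maximalIdeal S := by
    by_contra! hcon
    have h1 := hx.paramMonomial_notMem fun _ => p - 1
    simp only [hp1] at h1
    exact h1 (hfrob ▸ hmem _ hcon)
  let Φ : S →+ S := ψ i₀
  have hΦ : ∀ r y : S, Φ (r ^ p * y) = r * Φ y := hψ i₀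
  -- nondegeneracy modulo the maximal ideal
  have hnd : ∀ g : S, (∀ r, Φ (r * g) ∈ maximalIdeal S) →
      g ∈ frobeniusPower p (maximalIdeal S) := by
    intro g hg
    have hle : maximalIdeal S ^ (n * (p - 1) + 1) ≤ frobeniusPower p (maximalIdeal S) := by
      have := span_range_pow_le_frobeniusPower (p := p) x 0
      simpa [hx.span_eq] using this
    obtain ⟨A, u, hA, hgA⟩ := hx.exists_expansion g (n * (p - 1) + 1)
    by_contra hgm
    have hex : ∃ a ∈ A, ∀ i, a i < p := by
      by_contra! hcon
      refine hgm ?_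
      rw [← sub_add_cancel g (∑ a ∈ A, u a * paramMonomial x a)]
      refine add_mem (hle hgA) (Ideal.sum_mem _ fun a ha => Ideal.mul_mem_left _ _ ?_)
      obtain ⟨i, hi⟩ := hcon a ha
      refine paramMonomial_mem_of_le x (b := Pi.single i p) (fun j => ?_) ?_
      · by_cases hj : j = i
        · subst hj; simpa using hi
        · simp [hj]
      · rw [paramMonomial_single, hfrob]
        exact Ideal.subset_span ⟨i, rfl⟩
    obtain ⟨a, ha⟩ := (A.filter fun a => ∀ i, a i < p).exists_minimal (by
      obtain ⟨a, ha, h⟩ := hex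
      exact ⟨a, Finset.mem_filter.2 ⟨ha, h⟩⟩)
    have haA := (Finset.mem_filter.1 ha.1).1
    have hap := (Finset.mem_filter.1 ha.1).2
    -- multiplying `g` by this monomial moves the term of `a` into the socle and kills the others
    set e : Fin n → ℕ := fun i => p - 1 - a i with he
    have hae : a + e = fun _ => p - 1 := by
      funext i
      have := hap i
      simp only [he, Pi.add_apply]
      omega
    have hdiff : u a * paramMonomial x (fun _ => p - 1) - paramMonomial x e * g ∈
        frobeniusPower p (maximalIdeal S) := by
      have h1 : u a * paramMonomial x (fun _ => p - 1) - paramMonomial x e * g =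
          - (paramMonomial x e * (g - ∑ a ∈ A, u a * paramMonomial x a)) -
            ∑ d ∈ A.erase a, u d * paramMonomial x (d + e) := by
        rw [← Finset.add_sum_erase A _ haA, ← hae]
        simp only [paramMonomial_add, ← mul_assoc]
        rw [← Finset.sum_mul]
        ring
      rw [h1]
      refine sub_mem (neg_mem (Ideal.mul_mem_left _ _ (hle hgA)))
        (Ideal.sum_mem _ fun d hd => Ideal.mul_mem_left _ _ ?_)
      obtain ⟨hda, hdA⟩ := Finset.mem_erase.1 hd
      obtain ⟨i, hi⟩ : ∃ i, p ≤ (d + e) i := by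
        by_contra! hcon
        have hle : d ≤ a := fun i => by
          have h1 := hcon i
          have h2 := hap i
          change d i + (p - 1 - a i) < p at h1
          change d i ≤ a i
          omega
        have hdp : ∀ i, d i < p := fun i => (hle i).trans_lt (hap i)
        exact hda (le_antisymm hle (ha.2 (Finset.mem_filter.2 ⟨hdA, hdp⟩) hle))
      refine paramMonomial_mem_of_le x (b := Pi.single i p) (fun j => ?_) ?_
      · by_cases hj : j = i
        · subst hj; simpa using hi
        · simp [hj]
      · rw [paramMonomial_single, hfrob]
        exact Ideal.subset_span ⟨i, rfl⟩
    obtain ⟨v, hv⟩ := (hA a haA).1.exists_left_inv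
    have h2 : paramMonomial x (fun _ => p - 1) =
        v * (u a * paramMonomial x (fun _ => p - 1) - paramMonomial x e * g) +
          v * paramMonomial x e * g := by
      linear_combination (- paramMonomial x (fun _ => p - 1)) * hv
    refine hi₀ ?_
    change Φ (paramMonomial x fun _ => p - 1) ∈ maximalIdeal S
    rw [h2, map_add]
    exact add_mem (IsFrobeniusDualBasis.map_mem_of_mem_frobeniusPower hΦ
      (Ideal.mul_mem_left _ _ hdiff)) (hg _)
  -- the Gram matrix
  let G : Matrix (Fin _) (Fin _) S := Matrix.of fun i j => Φ (c i * c j)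
  have hG : IsUnit G.det := by
    by_contra hdet
    have h0 : ((residue S).mapMatrix G).det = 0 := by
      rw [← RingHom.map_det, residue_eq_zero_iff]
      exact hdet
    obtain ⟨v, hv0, hv⟩ := Matrix.exists_vecMul_eq_zero_iff.2 h0
    choose w hw using fun i => residue_surjective (v i)
    have hg := hnd (∑ i, w i ^ p * c i) (fun r => by
      rw [← hB r, Finset.sum_mul, map_sum]
      refine Ideal.sum_mem _ fun j _ => ?_
      rw [mul_assoc, hΦ]
      refine Ideal.mul_mem_left _ _ ?_
      rw [Finset.mul_sum, map_sum, ← residue_eq_zero_iff, map_sum]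
      have := congrFun hv j
      simp only [Matrix.vecMul, dotProduct, Pi.zero_apply] at this
      rw [← this]
      refine Finset.sum_congr rfl fun i _ => ?_
      rw [mul_left_comm, hΦ, map_mul, hw, mul_comm (c j)]
      rfl)
    refine hv0 (funext fun i => ?_)
    have h3 : B.repr (o (∑ i, w i ^ p * c i)) i = w i := by
      have : o (∑ i, w i ^ p * c i) = ∑ i, w i • B i := by
        rw [map_sum]; rfl
      rw [this, B.repr_sum_self]
    have h5 : ψ i (∑ i, w i ^ p * c i) ∈ maximalIdeal S :=
      IsFrobeniusDualBasis.map_mem_of_mem_frobeniusPower (hψ i) hg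
    have h6 : ψ i (∑ i, w i ^ p * c i) = w i := h3
    rw [h6, ← residue_eq_zero_iff, hw] at h5
    exact h5
  refine ⟨_, Φ, fun i => ∑ k, G⁻¹ i k ^ p * c k, c, hΦ, fun y => ?_⟩
  have hdual : ∀ i j, Φ ((∑ k, G⁻¹ i k ^ p * c k) * c j) = (1 : Matrix (Fin _) (Fin _) S) i j := by
    intro i j
    rw [← Matrix.nonsing_inv_mul G hG, Matrix.mul_apply, Finset.sum_mul, map_sum]
    refine Finset.sum_congr rfl fun k _ => ?_
    rw [mul_assoc, hΦ]
    rfl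
  have hcoord : ∀ i, Φ ((∑ k, G⁻¹ i k ^ p * c k) * y) = B.repr (o y) i := by
    intro i
    conv_lhs => rw [← hB y]
    rw [Finset.mul_sum, map_sum, Finset.sum_eq_single i]
    · rw [mul_left_comm, hΦ, hdual, Matrix.one_apply_eq, mul_one]
    · intro j _ hj
      rw [mul_left_comm, hΦ, hdual, Matrix.one_apply_ne hj.symm, mul_zero]
    · simp
  simp_rw [hcoord]
  exact hB y

end

section

open IsLocalRing Finset SymbolicFPure

/-! ### The trace map of a polynomial ring -/

namespace MvPolynomial

variable {K σ : Type*} [Field K] {p : ℕ}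

open Classical in
/-- The map that sends `α x ^ (p c + (p - 1, …, p - 1))` to `τ α x ^ c` and kills all terms whose
exponent is not congruent to `(p - 1, …, p - 1)` modulo `p`. -/
noncomputable def frobeniusTrace (p : ℕ) (τ : K →+ K) : MvPolynomial σ K →+ MvPolynomial σ K :=
  (Finsupp.liftAddHom fun a : σ →₀ ℕ =>
    if ∀ i, a i % p = p - 1 then
      (monomial (a.mapRange (· / p) (Nat.zero_div p))).toAddMonoidHom.comp τ
    else 0).comp AddMonoidAlgebra.coeffAddEquiv.toAddMonoidHom

theorem frobeniusTrace_monomial (τ : K →+ K) (a : σ →₀ ℕ) (α : K)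
    [Decidable (∀ i, a i % p = p - 1)] :
    frobeniusTrace p τ (monomial a α) =
      if ∀ i, a i % p = p - 1 then monomial (a.mapRange (· / p) (Nat.zero_div p)) (τ α) else 0 := by
  have : frobeniusTrace p τ (monomial a α) = (if ∀ i, a i % p = p - 1 then
      (monomial (a.mapRange (· / p) (Nat.zero_div p))).toAddMonoidHom.comp τ
    else 0 : K →+ MvPolynomial σ K) α := by
    classical
    rw [frobeniusTrace]
    refine (Finsupp.liftAddHom_apply_single _ a α).trans ?_
    congr
  rw [this]
  split_ifs <;> rfl

variable [hp : Fact p.Prime] [CharP K p]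

theorem frobeniusTrace_pow_mul {τ : K →+ K} (hτ : ∀ r y, τ (r ^ p * y) = r * τ y)
    (r y : MvPolynomial σ K) : frobeniusTrace p τ (r ^ p * y) = r * frobeniusTrace p τ y := by
  classical
  induction r using MvPolynomial.induction_on' with
  | add r s hr hs => rw [add_pow_char, add_mul, map_add, hr, hs, add_mul]
  | monomial e β =>
    induction y using MvPolynomial.induction_on' with
    | add y z hy hz => rw [mul_add, map_add, hy, hz, map_add, mul_add]
    | monomial a α =>
      have h1 : ∀ i, (p • e + a) i % p = a i % p := fun i => by simp
      have h2 : (p • e + a).mapRange (· / p) (Nat.zero_div p) =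
          e + a.mapRange (· / p) (Nat.zero_div p) := by
        ext i
        simp [Nat.mul_add_div hp.out.pos]
      rw [monomial_pow, monomial_mul, frobeniusTrace_monomial, frobeniusTrace_monomial]
      simp only [h1, h2, hτ]
      split_ifs
      · rw [monomial_mul]
      · rw [mul_zero]

/-- A dual basis for Frobenius on `K` gives one on `K[x_i : i ∈ σ]`, made of the products of its
elements with the monomials whose exponents are less than `p`. -/
theorem isFrobeniusDualBasis_frobeniusTrace [Fintype σ] [DecidableEq σ] {ι : Type*} [Fintype ι]
    {τ : K →+ K} {b c : ι → K} (h : IsFrobeniusDualBasis p τ b c) :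
    IsFrobeniusDualBasis p (frobeniusTrace (σ := σ) p τ)
      (fun k : (σ → Fin p) × ι =>
        monomial (Finsupp.equivFunOnFinite.symm fun i => p - 1 - (k.1 i : ℕ)) (b k.2))
      (fun k => monomial (Finsupp.equivFunOnFinite.symm fun i => (k.1 i : ℕ)) (c k.2)) := by
  classical
  have hpos := hp.out.pos
  refine ⟨frobeniusTrace_pow_mul h.map_pow_mul, fun y => ?_⟩
  induction y using MvPolynomial.induction_on' with
  | add y z hy hz =>
    conv_rhs => rw [← hy, ← hz, ← Finset.sum_add_distrib]
    refine Finset.sum_congr rfl fun k _ => ?_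
    rw [mul_add, map_add, add_pow_char, add_mul]
  | monomial a α =>
    -- only the exponent of residues of `a` contributes to the expansion of `α x ^ a`
    have hmod : ∀ r : σ → Fin p, (∀ i, (p - 1 - (r i : ℕ) + a i) % p = p - 1) ↔
        r = fun i => ⟨a i % p, Nat.mod_lt _ hpos⟩ := by
      intro r
      refine Iff.trans (forall_congr' fun i => ?_) _root_.funext_iff.symm
      rw [Fin.ext_iff]
      have h1 := (r i).2
      have h2 := Nat.div_add_mod (a i) p
      have h3 := Nat.mod_lt (a i) hpos
      have h4 : (p - 1 - (r i : ℕ) + a i) % p = (p - 1 - (r i : ℕ) + a i % p) % p := by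
        rw [Nat.add_mod_mod]
      rw [h4]
      constructor
      · intro h5
        by_cases h6 : a i % p ≤ r i
        · rw [Nat.mod_eq_of_lt (by omega)] at h5
          simp only
          omega
        · rw [Nat.mod_eq_sub_mod (by omega), Nat.mod_eq_of_lt (by omega)] at h5
          omega
      · intro h5
        simp only at h5
        rw [h5, Nat.sub_add_cancel (by omega), Nat.mod_eq_of_lt (by omega)]
    rw [Fintype.sum_prod_type, Finset.sum_eq_single fun i => ⟨a i % p, Nat.mod_lt _ hpos⟩]
    · have h1 : ∀ j, frobeniusTrace p τ (monomial (Finsupp.equivFunOnFinite.symm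
          fun i => p - 1 - a i % p) (b j) * monomial a α) ^ p *
            monomial (Finsupp.equivFunOnFinite.symm fun i => a i % p) (c j) =
          monomial a (τ (b j * α) ^ p * c j) := by
        intro j
        rw [monomial_mul, frobeniusTrace_monomial, if_pos, monomial_pow, monomial_mul]
        · refine congrArg (fun e => monomial e _) (Finsupp.ext fun i => ?_)
          have h2 := Nat.div_add_mod (a i) p
          have h3 := Nat.mod_lt (a i) hpos
          have h4 : (p - 1 - a i % p + a i) / p = a i / p := by
            have : p - 1 - a i % p + a i = p * (a i / p) + (p - 1) := by omega
            rw [this, Nat.mul_add_div hpos, Nat.div_eq_of_lt (by omega : p - 1 < p), add_zero]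
          simp [h4, h2]
        · exact (hmod fun i => ⟨a i % p, Nat.mod_lt _ hpos⟩).2 rfl
      simp_rw [h1]
      rw [← map_sum, h.sum_eq]
    · intro r _ hr
      refine Finset.sum_eq_zero fun j _ => ?_
      rw [monomial_mul, frobeniusTrace_monomial, if_neg, zero_pow hp.out.ne_zero, zero_mul]
      exact fun h => hr ((hmod r).1 h)
    · simp

theorem exists_isFrobeniusDualBasis [Fintype σ] [DecidableEq σ]
    (hF : (frobenius (MvPolynomial σ K) p).Finite) :
    ∃ (m : ℕ) (Φ : MvPolynomial σ K →+ MvPolynomial σ K)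
      (b c : (σ → Fin p) × Fin m → MvPolynomial σ K), IsFrobeniusDualBasis p Φ b c := by
  have hK : (frobenius K p).Finite := by
    have hc : (constantCoeff : MvPolynomial σ K →+* K).Finite :=
      RingHom.Finite.of_surjective _ fun a => ⟨C a, constantCoeff_C σ a⟩
    refine RingHom.Finite.of_comp_finite (f := (constantCoeff : MvPolynomial σ K →+* K)) ?_
    have : (frobenius K p).comp (constantCoeff : MvPolynomial σ K →+* K) =
        constantCoeff.comp (frobenius (MvPolynomial σ K) p) := by
      ext <;> simp [frobenius_def]
    rw [this]
    exact hc.comp hF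
  have hx : IsRegularSystem (Fin.elim0 : Fin 0 → K) :=
    ⟨by rw [Set.range_eq_empty, Ideal.span_empty, maximalIdeal_eq_bot], by simp⟩
  obtain ⟨m, τ, b, c, h⟩ := hx.exists_isFrobeniusDualBasis p hK
  exact ⟨_, _, _, _, isFrobeniusDualBasis_frobeniusTrace h⟩

end MvPolynomial

end

section

open IsLocalRing Finset SymbolicFPure

/-! ### Symbolic powers -/

namespace SymbolicFPure

variable {R : Type*} [CommRing R] {I : Ideal R}

theorem mem_symbolicPower {n : ℕ} {y : R} :
    y ∈ symbolicPower I n ↔ ∃ w ∈ minimalPrimesCompl I, w * y ∈ I ^ n := by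
  rw [symbolicPower, Ideal.mem_comap,
    IsLocalization.algebraMap_mem_map_algebraMap_iff (minimalPrimesCompl I)]

theorem pow_le_symbolicPower (n : ℕ) : I ^ n ≤ symbolicPower I n := Ideal.le_comap_map

/-- Symbolic powers can be computed by localizing at one minimal prime at a time. -/
theorem mem_symbolicPower_iff_forall [IsNoetherianRing R] {n : ℕ} {y : R} :
    y ∈ symbolicPower I n ↔ ∀ q ∈ I.minimalPrimes, ∃ s ∉ q, s * y ∈ I ^ n := by
  rw [mem_symbolicPower]
  refine ⟨fun ⟨w, hw, h⟩ q hq => ⟨w, hw q hq, h⟩, fun h => ?_⟩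
  by_contra! hcon
  -- otherwise the colon ideal `(I ^ n : y)` is covered by the minimal primes
  have hcov := (Ideal.subset_union_prime_finite I.finite_minimalPrimes_of_isNoetherianRing (f := id)
    ⊤ ⊤ (fun q hq _ _ => hq.1.1) (I := (I ^ n).colon {y})).1 (fun w hw => by
      by_contra hw'
      refine hcon w (fun q hq hwq => hw' (Set.mem_biUnion hq hwq)) ?_
      simpa [Submodule.mem_colon_singleton] using hw)
  obtain ⟨q, hq, hle⟩ := hcov
  obtain ⟨s, hs, hsy⟩ := h q hq
  exact hs (hle (by simpa [Submodule.mem_colon_singleton] using hsy))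

theorem isFiltration_symbolicPower : IsFiltration (symbolicPower I) where
  zero := by rw [symbolicPower, pow_zero, Ideal.one_eq_top, Ideal.map_top, Ideal.comap_top]
  succ_le n := Ideal.comap_mono (Ideal.map_mono (Ideal.pow_le_pow_right n.le_succ))
  mul_le n m := by
    rw [Ideal.mul_le]
    intro a ha b hb
    rw [mem_symbolicPower] at ha hb ⊢
    obtain ⟨v, hv, hva⟩ := ha
    obtain ⟨w, hw, hwb⟩ := hb
    refine ⟨v * w, mul_mem hv hw, ?_⟩
    rw [mul_mul_mul_comm, pow_add]
    exact Ideal.mul_mem_mul hva hwb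

theorem mem_colonIntersection {p : ℕ} {N : ℤ} {f : R} :
    f ∈ colonIntersection p I N ↔ ∀ n : ℕ, (n : ℤ) ≤ N → ∀ y ∈ symbolicPower I (n * p + 1),
      f * y ∈ frobeniusPower p (symbolicPower I (n + 1)) := by
  simp [colonIntersection, Submodule.mem_colon]

section Localization

variable {q : Ideal R} [q.IsPrime]

/-- A radical ideal becomes the maximal ideal in the localization at any of its minimal primes. -/
theorem map_eq_maximalIdeal_of_mem_minimalPrimes (hI : I.IsRadical) (hq : q ∈ I.minimalPrimes) :
    I.map (algebraMap R (Localization.AtPrime q)) = maximalIdeal (Localization.AtPrime q) := by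
  have h := IsLocalization.AtPrime.radical_map_of_mem_minimalPrimes (Localization.AtPrime q) q I hq
  rwa [IsLocalization.AtPrime.map_eq_maximalIdeal q,
    ← IsLocalization.map_radical q.primeCompl, hI.radical] at h

theorem map_symbolicPower (hI : I.IsRadical) (hq : q ∈ I.minimalPrimes) (n : ℕ) :
    (symbolicPower I n).map (algebraMap R (Localization.AtPrime q)) =
      maximalIdeal (Localization.AtPrime q) ^ n := by
  rw [← map_eq_maximalIdeal_of_mem_minimalPrimes hI hq, ← Ideal.map_pow]
  refine le_antisymm (Ideal.map_le_iff_le_comap.2 fun y hy => ?_)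
    (Ideal.map_mono (pow_le_symbolicPower n))
  obtain ⟨w, hw, hwy⟩ := mem_symbolicPower.1 hy
  exact (IsLocalization.algebraMap_mem_map_algebraMap_iff q.primeCompl _ _ _).2 ⟨w, hw q hq, hwy⟩

end Localization

theorem map_frobeniusPower {S : Type*} [CommRing S] (g : R →+* S) (p : ℕ) [ExpChar R p]
    [ExpChar S p] (J : Ideal R) :
    (frobeniusPower p J).map g = frobeniusPower p (J.map g) := by
  rw [frobeniusPower_eq_map, frobeniusPower_eq_map, Ideal.map_map, Ideal.map_map,
    RingHom.frobenius_comm]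

/-! ### The colon ideals of the symbolic powers -/

variable {p : ℕ} [hp : Fact p.Prime] [CharP R p]

/-- Membership in the first few colon ideals forces membership in all of them: at a minimal prime
`q` of height `h`, an element of the colon ideal for `n = N` lies in `q ^ (h (p - 1)) R_q`, which
is contained in the localization at `q` of all the colon ideals. -/
theorem exists_mul_mul_mem_frobeniusPower [IsRegularRing R] (hI : I.IsRadical) {q : Ideal R}
    (hq : q ∈ I.minimalPrimes) {h N : ℕ} (hh : q.height = h) (hN : h * (p - 1) ≤ p * (N + 1))
    {f : R} (hf : ∀ y ∈ symbolicPower I (N * p + 1),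
      f * y ∈ frobeniusPower p (symbolicPower I (N + 1)))
    {n : ℕ} {y : R} (hy : y ∈ symbolicPower I (n * p + 1)) :
    ∃ s ∉ q, s * (f * y) ∈ frobeniusPower p (I ^ (n + 1)) := by
  have hqp : q.IsPrime := hq.1.1
  have : ExpChar R p := ExpChar.prime hp.out
  let S := Localization.AtPrime q
  have hreg : IsRegularLocalRing S := IsRegularRing.isRegularLocalRing_localization q
  have : CharP S p := (CharP.charP_iff_prime_eq_zero hp.out).2 (by
    rw [← map_natCast (algebraMap R S), CharP.cast_eq_zero, map_zero])
  have : ExpChar S p := ExpChar.prime hp.out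
  have hht : (maximalIdeal S).height = h := by
    rw [← hh, ← IsLocalization.height_under q.primeCompl (maximalIdeal S),
      IsLocalization.AtPrime.under_maximalIdeal S q]
  obtain ⟨x, hx⟩ := IsRegularLocalRing.exists_isRegularSystem S hht
  have hfS : algebraMap R S f ∈ maximalIdeal S ^ (Fintype.card (Fin h) * (p - 1)) := by
    refine hx.mem_pow_of_forall_mul_mem (N := N) (by simpa using hN) fun z hz => ?_
    rw [← map_symbolicPower hI hq, IsLocalization.mem_map_algebraMap_iff q.primeCompl] at hz
    obtain ⟨⟨⟨y, hy⟩, s⟩, hys⟩ := hz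
    have h1 := Ideal.mem_map_of_mem (algebraMap R S) (hf y hy)
    rw [map_frobeniusPower, map_symbolicPower hI hq, map_mul, ← hys, ← mul_assoc,
      mul_comm _ (algebraMap R S _)] at h1
    exact (Ideal.unit_mul_mem_iff_mem _ (IsLocalization.map_units S s)).1 h1
  have hyS : algebraMap R S y ∈ maximalIdeal S ^ (n * p + 1) :=
    map_symbolicPower hI hq (n * p + 1) ▸ Ideal.mem_map_of_mem _ hy
  have hle := span_range_pow_le_frobeniusPower (p := p) x n
  rw [hx.span_eq, pow_add] at hle
  have hfy := hle (Ideal.mul_mem_mul hfS hyS)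
  rw [← map_mul, ← map_eq_maximalIdeal_of_mem_minimalPrimes hI hq, ← Ideal.map_pow,
    ← map_frobeniusPower, IsLocalization.algebraMap_mem_map_algebraMap_iff q.primeCompl] at hfy
  exact hfy

/-- Multiplication by an element of the first few colon ideals makes every `p⁻¹`-linear map
compatible with all symbolic powers. -/
theorem map_mul_mem_symbolicPower [IsRegularRing R] (hI : I.IsRadical) {H : ℕ}
    (hH : bigHeight I = H) {δ : ℤ} (hδ : δ = if p ≤ H then 1 else 0) {f : R}
    (hf : f ∈ colonIntersection p I (max 0 (H - 1 - δ))) {φ : R →+ R}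
    (hφ : ∀ r x : R, φ (r ^ p * x) = r * φ x) {n : ℕ} {y : R}
    (hy : y ∈ symbolicPower I (n * p + 1)) : φ (f * y) ∈ symbolicPower I (n + 1) := by
  rw [mem_symbolicPower_iff_forall]
  intro q hq
  have hqp : q.IsPrime := hq.1.1
  have hle : q.height ≤ H := hH ▸ le_iSup₂_of_le (f := fun q (_ : q ∈ I.minimalPrimes) => q.height)
    q hq le_rfl
  obtain ⟨h, hh⟩ := ENat.ne_top_iff_exists.1 (ne_top_of_le_ne_top (ENat.natCast_ne_top H) hle)
  rw [← hh] at hle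
  have hle' : h ≤ H := by exact_mod_cast hle
  obtain ⟨N, hN⟩ := Int.eq_ofNat_of_zero_le (le_max_left (0 : ℤ) (H - 1 - δ))
  rw [hN, mem_colonIntersection] at hf
  have hpos := hp.out.pos
  -- if `p ≤ h` then `h (p - 1) ≤ p (h - 1)`, which saves one step
  have hbound : h * (p - 1) ≤ p * (N + 1) := by
    by_cases hpH : p ≤ H
    · rw [if_pos hpH] at hδ
      by_cases hph : p ≤ h
      · have h1 : h ≤ N + 2 := by omega
        obtain ⟨k, rfl⟩ : ∃ k, p = k + 1 := ⟨p - 1, by omega⟩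
        simp only [Nat.add_sub_cancel]
        obtain ⟨l, rfl⟩ : ∃ l, h = l + 1 := ⟨h - 1, by omega⟩
        nlinarith
      · have h1 : h ≤ N + 1 := by omega
        calc h * (p - 1) ≤ (N + 1) * p := Nat.mul_le_mul h1 (Nat.sub_le _ _)
          _ = p * (N + 1) := mul_comm _ _
    · rw [if_neg hpH] at hδ
      have h1 : h ≤ N + 1 := by omega
      calc h * (p - 1) ≤ (N + 1) * p := Nat.mul_le_mul h1 (Nat.sub_le _ _)
        _ = p * (N + 1) := mul_comm _ _
  obtain ⟨s, hs, hsy⟩ := exists_mul_mul_mem_frobeniusPower hI hq hh.symm hbound (hf N (by simp)) hy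
  refine ⟨s, hs, ?_⟩
  rw [← hφ]
  refine IsFrobeniusDualBasis.map_mem_of_mem_frobeniusPower hφ ?_
  rw [← pow_sub_one_mul hp.out.ne_zero, mul_assoc]
  exact Ideal.mul_mem_left _ _ hsy

omit hp [CharP R p] in
/-- If `φ = Φ (f ·)` is a splitting compatible with the symbolic powers, then `f` lies in all colon
ideals, and `f ∉ m^[p]` because `Φ f = 1`. -/
theorem IsSymbolicFPure.not_colonIntersection_le {ι : Type*} [Fintype ι] {Φ : R →+ R} {b c : ι → R}
    (hΦ : IsFrobeniusDualBasis p Φ b c) (h : IsSymbolicFPure p I) {m : Ideal R} (hm : m ≠ ⊤)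
    (N : ℤ) : ¬ colonIntersection p I N ≤ frobeniusPower p m := by
  obtain ⟨-, φ, hφ, hφI⟩ := h
  obtain ⟨f, hf⟩ := hΦ.exists_eq_mul hφ.map_pow_mul
  intro hle
  have hfm : f ∈ frobeniusPower p m := by
    refine hle (mem_colonIntersection.2 fun n _ y hy => hΦ.mem_frobeniusPower fun r => ?_)
    rw [mul_left_comm, ← hf]
    exact hφI n _ (Ideal.mul_mem_left _ _ hy)
  refine hm ((Ideal.eq_top_iff_one m).2 ?_)
  rw [← hφ.map_one, hf, mul_one]
  exact IsFrobeniusDualBasis.map_mem_of_mem_frobeniusPower hΦ.map_pow_mul hfm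

/-- An element of the intersection of colon ideals outside `m^[p]` gives a `p⁻¹`-linear map that is
compatible with the symbolic powers and does not send `1` into `m`. -/
theorem exists_map_one_notMem [IsRegularRing R] {ι : Type*} [Fintype ι] {Φ : R →+ R} {b c : ι → R}
    (hΦ : IsFrobeniusDualBasis p Φ b c) (hI : I.IsRadical) {H : ℕ}
    (hH : bigHeight I = H) {δ : ℤ} (hδ : δ = if p ≤ H then 1 else 0) {m : Ideal R}
    (h : ¬ colonIntersection p I (max 0 (H - 1 - δ)) ≤ frobeniusPower p m) :
    ∃ φ : R →+ R, (∀ r x : R, φ (r ^ p * x) = r * φ x) ∧ φ 1 ∉ m ∧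
      ∀ n, ∀ y ∈ symbolicPower I (n * p + 1), φ y ∈ symbolicPower I (n + 1) := by
  obtain ⟨f, hf, hfm⟩ := Set.not_subset.1 h
  obtain ⟨r, hr⟩ : ∃ r, Φ (r * f) ∉ m := by
    by_contra! hcon
    exact hfm (hΦ.mem_frobeniusPower hcon)
  refine ⟨Φ.comp (AddMonoidHom.mulLeft (r * f)), fun s x => ?_, by simpa using hr,
    fun n y hy => ?_⟩
  · simp [mul_left_comm _ (s ^ p), hΦ.map_pow_mul]
  · have := map_mul_mem_symbolicPower hI hH hδ hf hΦ.map_pow_mul (Ideal.mul_mem_left _ r hy)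
    simpa [mul_assoc, mul_left_comm f r] using this

theorem isSymbolicFPure_iff_of_isLocalRing [IsLocalRing R] [IsRegularRing R]
    (hF : (frobenius R p).Finite) (hI : I.IsRadical) {H : ℕ} (hH : bigHeight I = H) {δ : ℤ}
    (hδ : δ = if p ≤ H then 1 else 0) :
    IsSymbolicFPure p I ↔ ¬ colonIntersection p I (max 0 (H - 1 - δ)) ≤
      frobeniusPower p (maximalIdeal R) := by
  have hreg : IsRegularLocalRing R := IsRegularLocalRing.of_isRegularRing_of_isLocalRing R
  obtain ⟨h, hh⟩ := ENat.ne_top_iff_exists.1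
    (Ideal.height_lt_top (I := maximalIdeal R) Ideal.IsPrime.ne_top').ne
  obtain ⟨x, hx⟩ := IsRegularLocalRing.exists_isRegularSystem R hh.symm
  obtain ⟨m, Φ, b, c, hΦ⟩ := hx.exists_isFrobeniusDualBasis p hF
  refine ⟨fun h => h.not_colonIntersection_le hΦ Ideal.IsPrime.ne_top' _, fun h => ?_⟩
  obtain ⟨φ, hφ, hφ1, hφI⟩ := exists_map_one_notMem hΦ hI hH hδ h
  obtain ⟨v, hv⟩ := (notMem_maximalIdeal.1 hφ1).exists_left_inv
  refine ⟨isFiltration_symbolicPower, (AddMonoidHom.mulLeft v).comp φ, ⟨fun r y => ?_, hv⟩,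
    fun n y hy => Ideal.mul_mem_left _ v (hφI n y hy)⟩
  simp [hφ, mul_left_comm]

end SymbolicFPure

end

section

open SymbolicFPure

/-! ### Homogeneous ideals and homogeneous parts of splittings -/

namespace MvPolynomial

variable {K σ : Type*} [Field K]

/-- The coaction `f ↦ ∑ d, f_d T ^ d` of the standard grading, where `f_d` is the component of `f`
of degree `d`. -/
noncomputable def gradingCoaction (K σ : Type*) [Field K] :
    MvPolynomial σ K →ₐ[K] Polynomial (MvPolynomial σ K) :=
  aeval fun i => Polynomial.C (X i) * Polynomial.X

theorem coeff_gradingCoaction (f : MvPolynomial σ K) (d : ℕ) :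
    (gradingCoaction K σ f).coeff d = homogeneousComponent d f := by
  induction f using MvPolynomial.induction_on' with
  | add f g hf hg => rw [map_add, Polynomial.coeff_add, hf, hg, map_add]
  | monomial a α =>
    have h1 : gradingCoaction K σ (monomial a α) =
        Polynomial.C (monomial a α) * Polynomial.X ^ a.degree := by
      have h2 : (a.prod fun _ k => (Polynomial.X : Polynomial (MvPolynomial σ K)) ^ k) =
          Polynomial.X ^ a.degree := by
        rw [Finsupp.prod, Finset.prod_pow_eq_pow_sum, Finsupp.degree_apply]
      rw [gradingCoaction, aeval_monomial, monomial_eq, Polynomial.C_mul, Finsupp.prod,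
        Finsupp.prod, map_prod]
      simp_rw [mul_pow, Finset.prod_mul_distrib, map_pow]
      rw [← h2, Finsupp.prod, mul_assoc, Polynomial.algebraMap_apply, algebraMap_eq]
    rw [h1, Polynomial.coeff_C_mul, Polynomial.coeff_X_pow, homogeneousComponent_of_mem
      (isHomogeneous_monomial α rfl)]
    simp

/-- A polynomial with a unit coefficient is a nonzerodivisor. -/
theorem _root_.Polynomial.eq_zero_of_mul_eq_zero_of_isUnit_coeff {B : Type*} [CommRing B]
    {P Q : Polynomial B} (h : P * Q = 0) {n : ℕ} (hn : IsUnit (P.coeff n)) : Q = 0 := by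
  refine (mul_left_mem_nonZeroDivisors_eq_zero_iff ?_).1 h
  rw [Polynomial.mem_nonZeroDivisors_iff]
  intro a ha
  have h1 := congrArg (fun P => Polynomial.coeff P n) ha
  simp only [Polynomial.coeff_smul, Polynomial.coeff_zero, smul_eq_mul] at h1
  exact hn.mul_left_eq_zero.1 h1

theorem exists_homogeneousComponent_notMem {q : Ideal (MvPolynomial σ K)} {s : MvPolynomial σ K}
    (hs : s ∉ q) : ∃ d, homogeneousComponent d s ∉ q := by
  by_contra! h
  refine hs ?_
  rw [← sum_homogeneousComponent s]
  exact q.sum_mem fun d _ => h d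

/-- The contraction to a polynomial ring of the localization of a homogeneous ideal `J` at any prime
`q` is homogeneous. If `s x ∈ J` with `s ∉ q`, then the polynomials `∑ d, s_d T ^ d` and
`∑ d, x_d T ^ d` have product zero modulo `J` localized at `q`. The first one has a unit
coefficient, so it is a nonzerodivisor by McCoy's theorem, and the second one vanishes. -/
theorem exists_mul_homogeneousComponent_mem {J q : Ideal (MvPolynomial σ K)} [q.IsPrime]
    (hJ : J.IsHomogeneous (homogeneousSubmodule σ K)) {s x : MvPolynomial σ K} (hs : s ∉ q)
    (hsx : s * x ∈ J) (d : ℕ) : ∃ t ∉ q, t * homogeneousComponent d x ∈ J := by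
  let S := Localization.AtPrime q
  obtain ⟨B, _, g, hg, hu⟩ : ∃ (B : Type _) (_ : CommRing B) (g : MvPolynomial σ K →+* B),
      (∀ y, g y = 0 ↔ ∃ t ∉ q, t * y ∈ J) ∧ ∀ y ∉ q, IsUnit (g y) := by
    refine ⟨S ⧸ J.map (algebraMap _ S), inferInstance,
      (Ideal.Quotient.mk _).comp (algebraMap _ S), fun y => ?_, fun y hy => ?_⟩
    · refine Ideal.Quotient.eq_zero_iff_mem.trans ?_
      exact IsLocalization.algebraMap_mem_map_algebraMap_iff q.primeCompl S J y
    · exact (IsLocalization.map_units S (⟨_, hy⟩ : q.primeCompl)).map (Ideal.Quotient.mk _)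
  have hmul : (gradingCoaction K σ s).map g * (gradingCoaction K σ x).map g = 0 := by
    rw [← Polynomial.map_mul, ← map_mul]
    ext n
    rw [Polynomial.coeff_map, coeff_gradingCoaction, Polynomial.coeff_zero, hg]
    exact ⟨1, fun h => Ideal.IsPrime.ne_top' ((Ideal.eq_top_iff_one q).2 h), by
      rw [one_mul]; exact homogeneousComponent_mem_of_mem hJ hsx n⟩
  obtain ⟨n, hn⟩ := exists_homogeneousComponent_notMem hs
  have h0 := Polynomial.eq_zero_of_mul_eq_zero_of_isUnit_coeff hmul (n := n) (by
    rw [Polynomial.coeff_map, coeff_gradingCoaction]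
    exact hu _ hn)
  rw [← hg, ← coeff_gradingCoaction, ← Polynomial.coeff_map, h0, Polynomial.coeff_zero]

theorem homogeneousComponent_mem_symbolicPower [Finite σ] {I : Ideal (MvPolynomial σ K)}
    (hI : I.IsHomogeneous (homogeneousSubmodule σ K)) {n : ℕ} {x : MvPolynomial σ K}
    (hx : x ∈ symbolicPower I n) (d : ℕ) : homogeneousComponent d x ∈ symbolicPower I n := by
  have hpow : (I ^ n).IsHomogeneous (homogeneousSubmodule σ K) := by
    induction n with
    | zero => rw [pow_zero, Ideal.one_eq_top]; exact Ideal.IsHomogeneous.top _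
    | succ n ih => rw [pow_succ]; exact (ih (isFiltration_symbolicPower.succ_le n hx)).mul hI
  rw [mem_symbolicPower_iff_forall] at hx ⊢
  intro q hq
  have := hq.1.1
  obtain ⟨s, hs, hsx⟩ := hx q hq
  exact exists_mul_homogeneousComponent_mem hpow hs hsx d

theorem homogeneousComponent_add_mul {r : MvPolynomial σ K} {m : ℕ} (hr : r.IsHomogeneous m) (k : ℕ)
    (f : MvPolynomial σ K) :
    homogeneousComponent (m + k) (r * f) = r * homogeneousComponent k f := by
  induction f using MvPolynomial.induction_on' with
  | add f g hf hg => rw [mul_add, map_add, hf, hg, map_add, mul_add]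
  | monomial a α =>
    have h1 := isHomogeneous_monomial (d := a) α rfl
    rw [homogeneousComponent_of_mem h1, homogeneousComponent_of_mem (hr.mul h1)]
    simp

open Classical in
/-- The degree preserving part of an additive map `φ`, viewed as a map from `R^{1/p}` to `R`: on
elements `x` of degree `p d` it is the component of `φ x` of degree `d`, and it vanishes on elements
whose degree is not divisible by `p`. -/
noncomputable def degreePreservingPart (p : ℕ) (φ : MvPolynomial σ K →+ MvPolynomial σ K) :
    MvPolynomial σ K →+ MvPolynomial σ K :=
  (Finsupp.liftAddHom fun a : σ →₀ ℕ =>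
    if p ∣ a.degree then
      ((homogeneousComponent (a.degree / p)).toAddMonoidHom.comp φ).comp (monomial a).toAddMonoidHom
    else 0).comp AddMonoidAlgebra.coeffAddEquiv.toAddMonoidHom

variable {p : ℕ} {φ : MvPolynomial σ K →+ MvPolynomial σ K}

theorem degreePreservingPart_of_isHomogeneous {x : MvPolynomial σ K} {d : ℕ}
    (hx : x.IsHomogeneous d) :
    degreePreservingPart p φ x = if p ∣ d then homogeneousComponent (d / p) (φ x) else 0 := by
  have hmon : ∀ (a : σ →₀ ℕ) (α : K), a.degree = d →
      degreePreservingPart p φ (monomial a α) =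
        if p ∣ d then homogeneousComponent (d / p) (φ (monomial a α)) else 0 := by
    rintro a α rfl
    classical
    refine (Finsupp.liftAddHom_apply_single _ a α).trans ?_
    split_ifs <;> rfl
  rw [x.as_sum, map_sum, map_sum]
  split_ifs with h
  · rw [map_sum]
    refine Finset.sum_congr rfl fun a ha => ?_
    rw [hmon a _ (by simpa [Finsupp.degree_eq_weight_one] using! hx (mem_support_iff.1 ha)),
      if_pos h]
  · refine Finset.sum_eq_zero fun a ha => ?_
    rw [hmon a _ (by simpa [Finsupp.degree_eq_weight_one] using! hx (mem_support_iff.1 ha)),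
      if_neg h]

theorem isDegreePreserving_degreePreservingPart [hp : Fact p.Prime] :
    IsDegreePreserving p (degreePreservingPart p φ) := by
  refine ⟨fun d x hx => ?_, fun d x hd hx => ?_⟩
  · rw [degreePreservingPart_of_isHomogeneous hx, if_pos (dvd_mul_right p d),
      Nat.mul_div_cancel_left d hp.out.pos]
    exact homogeneousComponent_isHomogeneous _ _
  · rw [degreePreservingPart_of_isHomogeneous hx, if_neg hd]

theorem degreePreservingPart_pow_mul [hp : Fact p.Prime] [CharP K p]
    (hφ : ∀ r x, φ (r ^ p * x) = r * φ x) (r y : MvPolynomial σ K) :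
    degreePreservingPart p φ (r ^ p * y) = r * degreePreservingPart p φ y := by
  induction r using MvPolynomial.induction_on' with
  | add r s hr hs => rw [add_pow_char, add_mul, map_add, hr, hs, add_mul]
  | monomial e β =>
    induction y using MvPolynomial.induction_on' with
    | add y z hy hz => rw [mul_add, map_add, hy, hz, map_add, mul_add]
    | monomial a α =>
      have h1 := isHomogeneous_monomial (d := a) α rfl
      have h2 := isHomogeneous_monomial (d := e) β rfl
      have h3 := (h2.pow p).mul h1
      rw [degreePreservingPart_of_isHomogeneous h3, degreePreservingPart_of_isHomogeneous h1, hφ]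
      have h4 : p ∣ e.degree * p + a.degree ↔ p ∣ a.degree :=
        (Nat.dvd_add_right (dvd_mul_left p _))
      have h5 : (e.degree * p + a.degree) / p = e.degree + a.degree / p := by
        rw [mul_comm, Nat.mul_add_div hp.out.pos]
      simp only [h4, h5]
      split_ifs
      · exact homogeneousComponent_add_mul h2 _ _
      · rw [mul_zero]

theorem degreePreservingPart_mem_symbolicPower [Finite σ] {I : Ideal (MvPolynomial σ K)}
    (hI : I.IsHomogeneous (homogeneousSubmodule σ K))
    {m n : ℕ} (h : ∀ x ∈ symbolicPower I m, φ x ∈ symbolicPower I n) {x : MvPolynomial σ K}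
    (hx : x ∈ symbolicPower I m) : degreePreservingPart p φ x ∈ symbolicPower I n := by
  rw [← sum_homogeneousComponent x, map_sum]
  refine Ideal.sum_mem _ fun d _ => ?_
  rw [degreePreservingPart_of_isHomogeneous (homogeneousComponent_isHomogeneous d x)]
  split_ifs
  · exact homogeneousComponent_mem_symbolicPower hI
      (h _ (homogeneousComponent_mem_symbolicPower hI hx d)) _
  · exact zero_mem _

end MvPolynomial

namespace SymbolicFPure

open MvPolynomial

variable {K σ : Type*} [Field K] [Finite σ] {p : ℕ} {I : Ideal (MvPolynomial σ K)}

omit [Finite σ] in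
theorem IsGradedSymbolicFPure.isSymbolicFPure (h : IsGradedSymbolicFPure p I) :
    IsSymbolicFPure p I := by
  obtain ⟨h1, φ, h2, -, h3⟩ := h
  exact ⟨h1, φ, h2, h3⟩

omit [Finite σ] in
theorem mem_idealOfVars_iff {f : MvPolynomial σ K} : f ∈ idealOfVars σ K ↔ coeff 0 f = 0 := by
  rw [← pow_one (idealOfVars σ K), mem_pow_idealOfVars_iff']
  simp [Finsupp.degree_eq_zero_iff]

variable [Fact p.Prime] [CharP K p]

/-- For a homogeneous radical ideal of a polynomial ring, the colon criterion, symbolic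
`F`-purity and its graded form are equivalent. -/
theorem isSymbolicFPure_tfae (hF : (frobenius (MvPolynomial σ K) p).Finite) (hI : I.IsRadical)
    (hIh : I.IsHomogeneous (homogeneousSubmodule σ K)) {H : ℕ} (hH : bigHeight I = H) {δ : ℤ}
    (hδ : δ = if p ≤ H then 1 else 0) :
    List.TFAE [IsGradedSymbolicFPure p I, IsSymbolicFPure p I,
      ¬ colonIntersection p I (max 0 (H - 1 - δ)) ≤ frobeniusPower p (idealOfVars σ K)] := by
  classical
  have := Fintype.ofFinite σ
  obtain ⟨m, Φ, b, c, hΦ⟩ := MvPolynomial.exists_isFrobeniusDualBasis hF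
  tfae_have 1 → 2 := IsGradedSymbolicFPure.isSymbolicFPure
  tfae_have 2 → 3 := fun h => h.not_colonIntersection_le hΦ (fun htop => by
    have := (Ideal.eq_top_iff_one _).1 htop
    rw [mem_idealOfVars_iff] at this
    simp at this) _
  tfae_have 3 → 1 := fun h => by
    obtain ⟨φ, hφ, hφ1, hφI⟩ := exists_map_one_notMem hΦ hI hH hδ h
    rw [mem_idealOfVars_iff] at hφ1
    set u := coeff 0 (φ 1) with hu
    -- the degree preserving part sends `1` to the constant term of `φ 1`
    have h1 : degreePreservingPart p φ 1 = C u := by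
      rw [degreePreservingPart_of_isHomogeneous (isHomogeneous_one σ K), if_pos (dvd_zero p),
        Nat.zero_div, homogeneousComponent_zero]
    refine ⟨isFiltration_symbolicPower,
      (AddMonoidHom.mulLeft (C u⁻¹)).comp (degreePreservingPart p φ), ⟨fun r x => ?_, ?_⟩,
      ⟨fun d x hx => ?_, fun d x hd hx => ?_⟩, fun n y hy => ?_⟩
    · simp [degreePreservingPart_pow_mul hφ, mul_left_comm]
    · simp [h1, ← C_mul, inv_mul_cancel₀ hφ1]
    · have := (isHomogeneous_C σ u⁻¹).mul
        ((isDegreePreserving_degreePreservingPart (φ := φ)).1 d x hx)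
      rw [zero_add] at this
      exact this
    · simp [isDegreePreserving_degreePreservingPart.2 d x hd hx]
    · exact Ideal.mul_mem_left _ _ (degreePreservingPart_mem_symbolicPower hIh (hφI n) hy)
  tfae_finish

end SymbolicFPure

end

theorem mainTheorem3 (p : ℕ) [Fact p.Prime] :
    (∀ (R : Type*) [CommRing R] [IsLocalRing R] [IsRegularRing R] [CharP R p],
      (frobenius R p).Finite →
      ∀ I : Ideal R, I.IsRadical →
      ∀ H : ℕ, bigHeight I = H →
      ∀ δ : ℤ, δ = (if p ≤ H then 1 else 0) →
      (IsSymbolicFPure p I ↔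
        ¬ colonIntersection p I (max 0 (H - 1 - δ)) ≤
          frobeniusPower p (IsLocalRing.maximalIdeal R))) ∧
    (∀ (K σ : Type*) [Field K] [Finite σ] [CharP K p],
      (frobenius (MvPolynomial σ K) p).Finite →
      ∀ I : Ideal (MvPolynomial σ K), I.IsRadical →
      I.IsHomogeneous (MvPolynomial.homogeneousSubmodule σ K) →
      ∀ H : ℕ, bigHeight I = H →
      ∀ δ : ℤ, δ = (if p ≤ H then 1 else 0) →
      (IsSymbolicFPure p I ↔
        ¬ colonIntersection p I (max 0 (H - 1 - δ)) ≤
          frobeniusPower p (MvPolynomial.idealOfVars σ K)) ∧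
      (IsGradedSymbolicFPure p I ↔
        ¬ colonIntersection p I (max 0 (H - 1 - δ)) ≤
          frobeniusPower p (MvPolynomial.idealOfVars σ K))) := by
  refine ⟨fun R _ _ _ _ hF I hI H hH δ hδ => ?_, fun K σ _ _ _ hF I hI hIh H hH δ hδ => ?_⟩
  · exact isSymbolicFPure_iff_of_isLocalRing hF hI hH hδ
  · have h := isSymbolicFPure_tfae hF hI hIh hH hδ
    exact ⟨h.out 1 2, h.out 0 2⟩
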